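/- **Setting.** Time is slotted, $t=1,2,\dots$. A data center has $N$ generators of capacity $L>0$, with startup cost $\beta_g>0$, sunk cost $c_m\ge 0$ per active slot and incremental cost $c_o\ge 0$ per unit of energy; turning a server on costs $\beta_s>0$. An input consists of a horizon $T$, workloads $a(t)\ge 0$, grid prices $p(t)$ with $0\le P_{\min}\le p(t)\le P_{\max}$, and nonnegative functions $g_t(x,a)$, increasing and convex in $x$ and in $a$ (for $x,a\ge0$). Put $d_t(x)=g_t(x,a(t))$, and let $d_{\min}\ge 0$ be a known lower bound of $d_t(1)-d_t(0)$ (for instance its minimum over $t$). Assume $0<c_o+c_m/L<P_{\max}$. Costs are charged in slots $1,\dots,T$ only; look-ahead windows may extend beyond $T$, where the input satisfies the same bounds and, in addition, $a(t)=0$ and $g_t(0,0)=0$ for $t>T$ (no workload, and no power consumption without active servers). **DCM.** For $y\in\mathbb N_0$ and $e\ge 0$ let $\psi(y,p,e)=c_my+pe$ if $p\le c_o$; $\psi(y,p,e)=c_my+c_oLy+p(e-Ly)$ if $p>c_o$ and $e>Ly$; and $\psi(y,p,e)=c_my+c_oe$ otherwise. Problem DCM is to minimize $$\sum_{t=1}^T\Big\{\psi\big(y(t),p(t),d_t(x(t))\big)+\beta_s[x(t)-x(t-1)]^++\beta_g[y(t)-y(t-1)]^+\Big\}$$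 over $x(t),y(t)\in\mathbb N_0$ with $x(t)\ge a(t)$, $y(t)\le N$ $(1\le t\le T)$, $x(0)=y(0)=0$. **GCSR$^{(w)}$.** Let $M=\max_{1\le t\le T}\lceil a(t)\rceil$ and, for $1\le i\le M$, $a_i(t)=\min\{1,\max\{0,a(t)-(i-1)\}\}$ and $d_t^i=d_t(i)-d_t(i-1)$. Server $i$ starts with $x_i(0)=0$, $C_i=0$. At slot $t$: if $a_i(t)>0$, set $x_i(t)=1$, $C_i=0$. Otherwise let $\tau'$ be the first $t'\in[t,t+w]$ with $C_i+\sum_{\tau=t}^{t'}p(\tau)d^i_\tau\ge\beta_s$; if $\tau'$ does not exist or $a_i(\tau)>0$ for some $\tau\in[t,\tau']$, set $x_i(t)=x_i(t-1)$ and add $p(t)d_t^ix_i(t)$ to $C_i$; else set $x_i(t)=0$, $C_i=0$. The output is $x^{on}(t)=\sum_{i=1}^M x_i(t)$. **CHASE$^{(v)}$** ($v\ge 0$ real) on prices $p$ and demand $e$. For $1\le i\le N$ let $e_i(t)=\min\{L,\max\{0,e(t)-(i-1)L\}\}$, $r_i(t)=\psi(0,p(t),e_i(t))-\psi(1,p(t),e_i(t))$,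 $R_i(0)=-\beta_g$, $R_i(t)=\min\{0,\max\{-\beta_g,R_i(t-1)+r_i(t)\}\}$, $y_i(0)=0$. At slot $t$ let $\tau'$ be the first integer $\tau\in[t,t+v]$ with $R_i(\tau)\in\{0,-\beta_g\}$; set $y_i(t)=y_i(t-1)$ if $\tau'$ does not exist, $y_i(t)=1$ if $R_i(\tau')=0$, and $y_i(t)=0$ otherwise. The output is $\sum_{i=1}^N y_i(t)$. **DCMON$^{(w)}$** ($w\in\mathbb N_0$) outputs $x^{on}$ from GCSR$^{(w)}$ and $y^{on}$ from CHASE$^{([w-\Delta_s]^+)}$ applied to $p$ and $e(t)=d_t(x^{on}(t))$, where $\Delta_s=\beta_s/(d_{\min}P_{\min})$ (and $\Delta_s=\infty$, $w/\Delta_s=0$, $[w-\Delta_s]^+=0$ if $d_{\min}P_{\min}=0$). **Theorem.** DCMON$^{(w)}$ is an online algorithm with look-ahead $w$: $x^{on}(t)$ and $y^{on}(t)$ depend only on the input in slots $1,\dots,t+w$. Its output is feasible for DCM, and on every input its cost is at most $$\frac{P_{\max}(2-\alpha_s)}{c_o+c_m/L}\left[1+\frac{2(LP_{\max}-Lc_o-c_m)}{LP_{\max}+\alpha_gP_{\max}\left(L-\frac{c_m}{P_{\max}-c_o}\right)}\right]$$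 times the cost of every feasible solution of DCM, hence times the optimum. This ratio is at most $$\frac{P_{\max}(2-\alpha_s)}{c_o+c_m/L}\left[1+2\,\frac{P_{\max}-c_o}{P_{\max}}\cdot\frac1{1+\alpha_g}\right].$$ Here $\alpha_s=\min(1,w/\Delta_s)\in[0,1]$ and $\alpha_g=\frac{c_m}{\beta_g}[w-\Delta_s]^+\in[0,\infty)$. -/

import Mathlib

/-- Parameters of a hybrid data center: the number `N` of generators, the switching cost `betaS` of
a server, the startup cost `betaG` of a generator, the sunk cost `cm` per slot of an active
generator, the incremental cost `co` per unit of on-site energy, the capacity `L` of a generator,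
the bounds `Pmin`, `Pmax` on the grid price, and the lower bound `dmin` on the power
consumption `d_t(1) - d_t(0)` of a first server. -/
structure DCParams where
  N : ℕ
  betaS : ℝ
  betaG : ℝ
  cm : ℝ
  co : ℝ
  L : ℝ
  Pmin : ℝ
  Pmax : ℝ
  dmin : ℝ

/-- Standing assumptions on the parameters. -/
structure DCParams.Valid (P : DCParams) : Prop where
  betaS_pos : 0 < P.betaS
  betaG_pos : 0 < P.betaG
  cm_nonneg : 0 ≤ P.cm
  co_nonneg : 0 ≤ P.co
  L_pos : 0 < P.L
  Pmin_nonneg : 0 ≤ P.Pmin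
  dmin_nonneg : 0 ≤ P.dmin
  onsite_pos : 0 < P.co + P.cm / P.L
  onsite_lt : P.co + P.cm / P.L < P.Pmax

/-- An input: horizon `T`, workload `a`, grid price `p`, power consumption functions `g t x a`.
The slots are `1, 2, 3, …`; costs are only charged in the slots `1, …, T`. The values at
slots after `T` are only what a look-ahead window that extends beyond the horizon sees. -/
structure DCInput where
  T : ℕ
  a : ℕ → ℝ
  p : ℕ → ℝ
  g : ℕ → ℝ → ℝ → ℝ

namespace DCInput

/-- `d_t(n) = g_t(n, a(t))`, the power consumption with `n` active servers. -/
def d (I : DCInput) (t n : ℕ) : ℝ := I.g t n (I.a t)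

/-- Admissible inputs: nonnegative workload, prices in `[Pmin, Pmax]`, power consumption that is
nonnegative, and increasing and convex in each of its two arguments. After the horizon there is no
workload, and a data center without active servers consumes no power. -/
structure Valid (I : DCInput) (P : DCParams) : Prop where
  workload_nonneg : ∀ t, 1 ≤ t → 0 ≤ I.a t
  price_ge : ∀ t, 1 ≤ t → P.Pmin ≤ I.p t
  price_le : ∀ t, 1 ≤ t → I.p t ≤ P.Pmax
  power_nonneg : ∀ t, 1 ≤ t → ∀ x a : ℝ, 0 ≤ x → 0 ≤ a → 0 ≤ I.g t x a
  power_mono_left : ∀ t, 1 ≤ t → ∀ a : ℝ, 0 ≤ a → MonotoneOn (fun x => I.g t x a) (Set.Ici 0)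
  power_mono_right : ∀ t, 1 ≤ t → ∀ x : ℝ, 0 ≤ x → MonotoneOn (fun a => I.g t x a) (Set.Ici 0)
  power_convex_left : ∀ t, 1 ≤ t → ∀ a : ℝ, 0 ≤ a → ConvexOn ℝ (Set.Ici 0) (fun x => I.g t x a)
  power_convex_right : ∀ t, 1 ≤ t → ∀ x : ℝ, 0 ≤ x → ConvexOn ℝ (Set.Ici 0) (fun a => I.g t x a)
  dmin_le : ∀ t, 1 ≤ t → P.dmin ≤ I.d t 1 - I.d t 0
  workload_after : ∀ t, I.T < t → I.a t = 0
  power_after : ∀ t, I.T < t → I.g t 0 0 = 0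

/-- The two inputs coincide in the slots `1, …, s`. -/
def AgreeUpTo (I J : DCInput) (s : ℕ) : Prop :=
  ∀ t, 1 ≤ t → t ≤ s → I.a t = J.a t ∧ I.p t = J.p t ∧ I.g t = J.g t

end DCInput

/-- `ψ(y, p, e)`: the least cost in one slot of supplying the power `e` with `y` active generators
at grid price `p`. -/
noncomputable def DCParams.psi (P : DCParams) (y : ℕ) (p e : ℝ) : ℝ :=
  if p ≤ P.co then P.cm * y + p * e
  else if P.L * y < e then P.cm * y + P.co * P.L * y + p * (e - P.L * y)
  else P.cm * y + P.co * e

namespace DCInput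

/-- Feasible solutions of the data center cost minimization problem. -/
structure Feasible (I : DCInput) (P : DCParams) (x y : ℕ → ℕ) : Prop where
  x_zero : x 0 = 0
  y_zero : y 0 = 0
  workload_le : ∀ t, 1 ≤ t → t ≤ I.T → I.a t ≤ x t
  y_le : ∀ t, 1 ≤ t → t ≤ I.T → y t ≤ P.N

/-- The objective function of the data center cost minimization problem. -/
noncomputable def cost (I : DCInput) (P : DCParams) (x y : ℕ → ℕ) : ℝ :=
  ∑ t ∈ Finset.Icc 1 I.T,
    (P.psi (y t) (I.p t) (I.d t (x t))
      + P.betaS * max 0 ((x t : ℝ) - (x (t - 1) : ℝ))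
      + P.betaG * max 0 ((y t : ℝ) - (y (t - 1) : ℝ)))

/-! ### Server provisioning (GCSR). Servers are numbered `0, 1, 2, …`. -/

/-- The sub-workload of server `i`. -/
noncomputable def subWorkload (I : DCInput) (i t : ℕ) : ℝ := min 1 (max 0 (I.a t - i))

/-- The additional power consumption due to server `i`. -/
def subPower (I : DCInput) (i t : ℕ) : ℝ := I.d t (i + 1) - I.d t i

/-- The number of servers, `M = max_{1 ≤ t ≤ T} ⌈a(t)⌉`. -/
noncomputable def numServers (I : DCInput) : ℕ := (Finset.Icc 1 I.T).sup fun t => ⌈I.a t⌉₊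

/-- With accumulated idling cost `C`, the first slot `s` in the window `[t, t + w]` until which the
idling cost would reach `betaS` exists, and there is no workload in `[t, s]`. -/
def GcsrOff (I : DCInput) (P : DCParams) (w i t : ℕ) (C : ℝ) : Prop :=
  ∃ s, IsLeast {s | s ∈ Set.Icc t (t + w) ∧
      P.betaS ≤ C + ∑ u ∈ Finset.Icc t s, I.p u * I.subPower i u} s ∧
    ∀ u ∈ Set.Icc t s, ¬ 0 < I.subWorkload i u

open Classical in
/-- The state (on or off, accumulated idling cost) of server `i` after each slot, under GCSR with
look-ahead window `w`. -/
noncomputable def gcsrState (I : DCInput) (P : DCParams) (w i : ℕ) : ℕ → ℕ × ℝ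
  | 0 => (0, 0)
  | t + 1 =>
    if 0 < I.subWorkload i (t + 1) then (1, 0)
    else if I.GcsrOff P w i (t + 1) (gcsrState I P w i t).2 then (0, 0)
    else ((gcsrState I P w i t).1,
      (gcsrState I P w i t).2 + I.p (t + 1) * I.subPower i (t + 1) * (gcsrState I P w i t).1)

/-- The number of active servers under GCSR with look-ahead window `w`. -/
noncomputable def gcsr (I : DCInput) (P : DCParams) (w t : ℕ) : ℕ :=
  ∑ i ∈ Finset.range I.numServers, (I.gcsrState P w i t).1

end DCInput

namespace DCParams

/-! ### Generator provisioning (CHASE) for prices `p` and power demands `e`. Generators are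
numbered `0, 1, …, N - 1`. -/

/-- The sub-demand of generator `i`. -/
noncomputable def subDemand (P : DCParams) (e : ℕ → ℝ) (i t : ℕ) : ℝ :=
  min P.L (max 0 (e t - i * P.L))

/-- The one-slot cost difference between not using and using generator `i`. -/
noncomputable def costDiff (P : DCParams) (p e : ℕ → ℝ) (i t : ℕ) : ℝ :=
  P.psi 0 (p t) (P.subDemand e i t) - P.psi 1 (p t) (P.subDemand e i t)

/-- The cumulative cost difference `R_i(t)`, kept within `[-betaG, 0]`. -/
noncomputable def cumDiff (P : DCParams) (p e : ℕ → ℝ) (i : ℕ) : ℕ → ℝ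
  | 0 => -P.betaG
  | t + 1 => min 0 (max (-P.betaG) (cumDiff P p e i t + P.costDiff p e i (t + 1)))

/-- `s` is the first slot in the window `[t, t + v]` where `R_i` is `0` or `-betaG`. -/
def FirstHit (P : DCParams) (p e : ℕ → ℝ) (v i t s : ℕ) : Prop :=
  IsLeast {s | s ∈ Set.Icc t (t + v) ∧
    (P.cumDiff p e i s = 0 ∨ P.cumDiff p e i s = -P.betaG)} s

open Classical in
/-- The state (on or off) of generator `i` under CHASE with look-ahead window `v`. -/
noncomputable def chaseState (P : DCParams) (p e : ℕ → ℝ) (v i : ℕ) : ℕ → ℕ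
  | 0 => 0
  | t + 1 =>
    if ¬ ∃ s, P.FirstHit p e v i (t + 1) s then chaseState P p e v i t
    else if ∃ s, P.FirstHit p e v i (t + 1) s ∧ P.cumDiff p e i s = 0 then 1
    else 0

/-- The number of active generators under CHASE with look-ahead window `v`. -/
noncomputable def chase (P : DCParams) (p e : ℕ → ℝ) (v t : ℕ) : ℕ :=
  ∑ i ∈ Finset.range P.N, P.chaseState p e v i t

/-! ### Look-ahead windows and ratios -/

/-- The length `[w - Δ_s]⁺` of the look-ahead window that is left to CHASE, where
`Δ_s = betaS / (dmin * Pmin)` is the break-even interval, infinite if `dmin * Pmin = 0`. -/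
noncomputable def remainingWindow (P : DCParams) (w : ℕ) : ℝ :=
  if P.dmin * P.Pmin = 0 then 0 else max 0 (w - P.betaS / (P.dmin * P.Pmin))

/-- `α_s = min(1, w / Δ_s)`, which is `0` if `Δ_s` is infinite. -/
noncomputable def alphaS (P : DCParams) (w : ℕ) : ℝ :=
  min 1 (w * (P.dmin * P.Pmin) / P.betaS)

/-- `α_g = (c_m / β_g) [w - Δ_s]⁺`. -/
noncomputable def alphaG (P : DCParams) (w : ℕ) : ℝ := P.cm / P.betaG * P.remainingWindow w

/-- The competitive ratio. -/
noncomputable def ratio (P : DCParams) (w : ℕ) : ℝ :=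
  P.Pmax * (2 - P.alphaS w) / (P.co + P.cm / P.L) *
    (1 + 2 * (P.L * P.Pmax - P.L * P.co - P.cm) /
      (P.L * P.Pmax + P.alphaG w * P.Pmax * (P.L - P.cm / (P.Pmax - P.co))))

/-- The simpler upper bound of the competitive ratio. -/
noncomputable def ratioBound (P : DCParams) (w : ℕ) : ℝ :=
  P.Pmax * (2 - P.alphaS w) / (P.co + P.cm / P.L) *
    (1 + 2 * ((P.Pmax - P.co) / P.Pmax) * (1 / (1 + P.alphaG w)))

end DCParams

namespace DCInput

/-! ### The combined algorithm DCMON with look-ahead window `w`: GCSR with window `w` for the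
servers, then CHASE, on the power demand of the active servers, with the integer slots of the
window `[t, t + [w - Δ_s]⁺]`. -/

/-- The number of active servers. -/
noncomputable def dcmonX (I : DCInput) (P : DCParams) (w t : ℕ) : ℕ := I.gcsr P w t

/-- The number of active generators. -/
noncomputable def dcmonY (I : DCInput) (P : DCParams) (w t : ℕ) : ℕ :=
  P.chase I.p (fun s => I.d s (I.dcmonX P w s)) ⌊P.remainingWindow w⌋₊ t

end DCInput

/-!
The two stages of DCMON are analyzed separately, and the results are multiplied.

*Servers.* With all power from the grid, the cost splits over the servers: the additional powers
`d_t(i+1) - d_t(i)` increase in `i` by convexity, so the level sets of any schedule are the cheapest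
way to have the same number of servers on. Each server then solves a ski rental problem. It is
turned off `w` slots before its idling cost reaches `β_s`, so it has idled for at most
`[β_s - w d_min P_min]⁺ = (1 - α_s) β_s` by then, and an amortized comparison with any other sequence
of states (`serverInvariant`) gives the ratio `2 - α_s` (`gridCost_gcsr_le`). Grid power costs at most
`F = P_max / (c_o + c_m / L)` times as much as any other supply (`gridCost_le_cost`).

*Generators.* CHASE only has to be compared with pure grid power. Sub-demands decrease in their
index, so the cost of CHASE is at most the grid cost plus, for each generator, the startup costs
minus the sum of the cost differences `r` of its active slots (`cost_chase_le`). In one cycle, `R`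
climbs from `-β_g` to `0` and falls back, and this excess is at most `2 β_g`, less what the look-ahead
saves at both ends. In return the climb, and the slots of an early turn-off, carry demand, whose
grid cost is at least `P_max / (P_max - c_o)` times `r + c_m`, where `r ≤ L P_max - L c_o - c_m`. The
invariant `ChaseInvariant` keeps this account and yields `excess_chase_le`. The integer window
contains `n + 1` slots for `n = ⌊[w - Δ_s]⁺⌋`, and the ratio for the real length `v < n + 1` follows if
`n ≥ 1` or `v = 0`.

*Short windows.* For `n = 0 < v`, CHASE has no look-ahead, and its ratio to grid power can exceed the
one for `v`, by up to `c_m v / 2` in the account of each cycle. Here the product bound has slack. As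
`v > 0`, GCSR is optimal for the grid, and keeping on, in addition to the servers of a solution `(x, y)`,
those that GCSR keeps on, costs at most what `x` saves in switching (`sum_jointDemand_le`). With the
demand of both, `F` times the cost of `(x, y)` exceeds the grid cost by the deficit in each cycle
of CHASE: between two starts of CHASE, `y` either starts the generator itself, or uses the grid when
CHASE starts, or runs the generator when CHASE has just stopped it (`mul_upSwitches_le_sum`,
`credit_add_deficit_le`).

*Online decisions.* If `[w - Δ_s]⁺ > 0`, every server without workload breaks even within `⌈Δ_s⌉` slots, so
that the demand in the window of CHASE depends on the slots up to `t + w` only (`gcsr_eq`).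
-/

/-! ### Power supply in a single slot -/

namespace DCParams

/-- The cost of a slot is the pure grid cost, plus the sunk cost of the active generators, minus what
they save on the energy that they supply. -/
lemma psi_eq {P : DCParams} (hP : P.Valid) (y : ℕ) (p e : ℝ) :
    P.psi y p e = p * e + P.cm * y - max 0 (p - P.co) * min e (P.L * y) := by
  have hL : 0 ≤ P.L * y := mul_nonneg hP.L_pos.le (Nat.cast_nonneg y)
  unfold psi
  split_ifs with h1 h2
  · rw [max_eq_left (by linarith)]; ring
  · rw [max_eq_right (by linarith), min_eq_right h2.le]; ring
  · rw [max_eq_right (by linarith), min_eq_left (by linarith)]; ring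

/-- The cost of serving more demand grows at most at the grid price. -/
lemma psi_le_add {P : DCParams} (hP : P.Valid) (y : ℕ) (p : ℝ) {e e' : ℝ}
    (hee : e ≤ e') : P.psi y p e' ≤ P.psi y p e + p * (e' - e) := by
  rw [psi_eq hP, psi_eq hP]
  have := mul_le_mul_of_nonneg_left (min_le_min_right (P.L * (y : ℝ)) hee)
    (le_max_left 0 (p - P.co))
  linarith

lemma subDemand_nonneg {P : DCParams} (hP : P.Valid) (e : ℕ → ℝ) (i t : ℕ) :
    0 ≤ P.subDemand e i t := le_min hP.L_pos.le (le_max_left _ _)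

lemma subDemand_le {P : DCParams} (e : ℕ → ℝ) (i t : ℕ) : P.subDemand e i t ≤ P.L := min_le_left _ _

lemma subDemand_mono {P : DCParams} {e e' : ℕ → ℝ} {t : ℕ} (h : e t ≤ e' t) (i : ℕ) :
    P.subDemand e i t ≤ P.subDemand e' i t := by
  unfold subDemand; gcongr

lemma sum_subDemand {P : DCParams} (hP : P.Valid) {e : ℕ → ℝ} {t : ℕ} (he : 0 ≤ e t) (n : ℕ) :
    ∑ i ∈ Finset.range n, P.subDemand e i t = min (e t) (P.L * n) := by
  induction n with
  | zero => simp [he]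
  | succ n ih =>
    rw [Finset.sum_range_succ, ih]
    unfold subDemand
    have hL := hP.L_pos
    push_cast
    rcases le_total (e t) (P.L * n) with h | h
    · rw [min_eq_left h, max_eq_left (by linarith), min_eq_right hL.le, min_eq_left (by linarith)]
      ring
    · rw [min_eq_right h, max_eq_right (by linarith)]
      rcases le_total (e t) (P.L * (n + 1)) with h' | h'
      · rw [min_eq_left h', min_eq_right (by linarith)]; ring
      · rw [min_eq_right h', min_eq_left (by linarith)]; ring

lemma sum_subDemand_le {P : DCParams} (hP : P.Valid) {e : ℕ → ℝ} {t : ℕ} (he : 0 ≤ e t) (n : ℕ) :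
    ∑ i ∈ Finset.range n, P.subDemand e i t ≤ e t :=
  (sum_subDemand hP he n).le.trans (min_le_left _ _)

/-- Any `#s` generators supply at most `min (e t) (L #s)`: sub-demands decrease in their index. -/
lemma sum_subDemand_finset_le {P : DCParams} (hP : P.Valid) {e : ℕ → ℝ} {t : ℕ} (he : 0 ≤ e t)
    (s : Finset ℕ) : ∑ i ∈ s, P.subDemand e i t ≤ min (e t) (P.L * s.card) := by
  refine le_min ?_ ?_
  · obtain ⟨n, hn⟩ := s.exists_nat_subset_range
    exact (Finset.sum_le_sum_of_subset_of_nonneg hn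
      fun i _ _ => subDemand_nonneg hP e i t).trans (sum_subDemand_le hP he n)
  · calc ∑ i ∈ s, P.subDemand e i t ≤ ∑ _i ∈ s, P.L :=
        Finset.sum_le_sum fun i _ => subDemand_le e i t
      _ = P.L * s.card := by rw [Finset.sum_const, nsmul_eq_mul, mul_comm]

lemma costDiff_eq {P : DCParams} (hP : P.Valid) (p e : ℕ → ℝ) (i t : ℕ) :
    P.costDiff p e i t = max 0 (p t - P.co) * P.subDemand e i t - P.cm := by
  have h0 := subDemand_nonneg hP e i t
  unfold costDiff
  rw [psi_eq hP, psi_eq hP]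
  push_cast
  simp only [mul_one, mul_zero]
  rw [min_eq_right h0, min_eq_left (subDemand_le e i t)]
  ring

/-- The largest cost difference `L P_max - L c_o - c_m` of a slot. -/
def maxDiff (P : DCParams) : ℝ := P.L * P.Pmax - P.L * P.co - P.cm

lemma maxDiff_pos {P : DCParams} (hP : P.Valid) : 0 < P.maxDiff := by
  have h := hP.onsite_lt
  have hL := hP.L_pos
  have h2 := mul_lt_mul_of_pos_left h hL
  rw [mul_add, mul_div_cancel₀ _ hL.ne'] at h2
  unfold maxDiff
  linarith

lemma co_lt_Pmax {P : DCParams} (hP : P.Valid) : P.co < P.Pmax :=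
  lt_of_le_of_lt (le_add_of_nonneg_right (div_nonneg hP.cm_nonneg hP.L_pos.le)) hP.onsite_lt

lemma Pmax_pos {P : DCParams} (hP : P.Valid) : 0 < P.Pmax := hP.onsite_pos.trans hP.onsite_lt

lemma costDiff_le {P : DCParams} (hP : P.Valid) {p : ℕ → ℝ} {t : ℕ} (hp : p t ≤ P.Pmax)
    (e : ℕ → ℝ) (i : ℕ) : P.costDiff p e i t ≤ P.maxDiff := by
  rw [costDiff_eq hP]
  have h1 : max 0 (p t - P.co) ≤ P.Pmax - P.co :=
    max_le (by linarith [co_lt_Pmax hP]) (by linarith)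
  have := mul_le_mul h1 (subDemand_le e i t) (subDemand_nonneg hP e i t)
    (by linarith [co_lt_Pmax hP])
  unfold maxDiff
  linarith

/-- The ratio of the saving to the grid cost of a unit of energy is largest at the price `Pmax`. -/
lemma saving_le {P : DCParams} (hP : P.Valid) {p e : ℝ} (hp0 : 0 ≤ p) (hp : p ≤ P.Pmax)
    (he : 0 ≤ e) : max 0 (p - P.co) * e ≤ (P.Pmax - P.co) / P.Pmax * (p * e) := by
  have hm := co_lt_Pmax hP
  have hPm := Pmax_pos hP
  rw [← mul_assoc]
  refine mul_le_mul_of_nonneg_right (max_le ?_ ?_) he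
  · exact mul_nonneg (div_nonneg (by linarith) hPm.le) hp0
  · rw [div_mul_eq_mul_div, le_div_iff₀ hPm]
    nlinarith [mul_le_mul_of_nonneg_left hp hP.co_nonneg]

/-- The factor `P_max / (c_o + c_m / L)` between grid energy at the highest price and energy from
fully loaded generators. -/
noncomputable def gridFactor (P : DCParams) : ℝ := P.Pmax / (P.co + P.cm / P.L)

lemma one_le_gridFactor {P : DCParams} (hP : P.Valid) : 1 ≤ P.gridFactor :=
  (one_le_div hP.onsite_pos).2 hP.onsite_lt.le

lemma gridFactor_mul {P : DCParams} (hP : P.Valid) :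
    P.gridFactor * (P.co * P.L + P.cm) = P.Pmax * P.L := by
  have h := hP.onsite_pos
  have hL := hP.L_pos
  unfold gridFactor
  have : P.co * P.L + P.cm = (P.co + P.cm / P.L) * P.L := by field_simp
  rw [this, ← mul_assoc, div_mul_cancel₀ _ h.ne']

/-- The slack of an active generator that supplies `e ≤ L` when on-site costs are scaled by
`gridFactor`. -/
lemma grid_le_onsite {P : DCParams} (hP : P.Valid) {p e : ℝ} (hp0 : 0 ≤ p) (hp : p ≤ P.Pmax)
    (he : 0 ≤ e) (heL : e ≤ P.L) :
    p * e ≤ P.gridFactor * (p * e + P.cm - max 0 (p - P.co) * e) := by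
  have hF := one_le_gridFactor hP
  have hF2 := gridFactor_mul hP
  have hL := hP.L_pos
  have hcm := hP.cm_nonneg
  rcases le_total p P.co with h | h
  · rw [max_eq_left (by linarith)]
    have := mul_nonneg hp0 he
    nlinarith
  · rw [max_eq_right (by linarith)]
    have h1 : p * e * P.L ≤ P.gridFactor * (P.co * e + P.cm) * P.L := by
      have h2 : P.gridFactor * (P.co * e + P.cm) * P.L
          = e * (P.gridFactor * (P.co * P.L + P.cm)) + P.gridFactor * P.cm * (P.L - e) := by ring
      have h3 : 0 ≤ P.gridFactor * P.cm * (P.L - e) :=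
        mul_nonneg (mul_nonneg (by linarith) hcm) (by linarith)
      have h4 : p * (e * P.L) ≤ P.Pmax * (e * P.L) :=
        mul_le_mul_of_nonneg_right hp (mul_nonneg he hL.le)
      rw [h2, hF2]; linarith
    have := le_of_mul_le_mul_right h1 hL
    linarith

/-- Scaled by `gridFactor`, the cost of a slot exceeds the pure grid cost by at least the sum of
the slacks of the generators. -/
lemma slack_le {P : DCParams} (hP : P.Valid) {p : ℝ} {e : ℕ → ℝ} {t n y : ℕ} (hp0 : 0 ≤ p)
    (he : 0 ≤ e t) (hy : y ≤ n) :
    ∑ i ∈ Finset.range n, ((P.gridFactor - 1) * (p * P.subDemand e i t)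
      + P.gridFactor * ((if i < y then 1 else 0) * (P.cm - max 0 (p - P.co) * P.subDemand e i t)))
    ≤ P.gridFactor * P.psi y p (e t) - p * e t := by
  rw [Finset.sum_add_distrib, ← Finset.mul_sum, ← Finset.mul_sum, ← Finset.mul_sum]
  have h1 := sum_subDemand_le hP he n
  have h2 : ∑ i ∈ Finset.range n, (if i < y then (1 : ℝ) else 0)
        * (P.cm - max 0 (p - P.co) * P.subDemand e i t)
      = P.cm * y - max 0 (p - P.co) * min (e t) (P.L * y) := by
    rw [← sum_subDemand hP he y]
    simp only [ite_mul, one_mul, zero_mul]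
    rw [← Finset.sum_filter]
    have : (Finset.range n).filter (fun i => i < y) = Finset.range y := by
      ext i; simp; omega
    rw [this, Finset.sum_sub_distrib, ← Finset.mul_sum]
    simp [mul_comm]
  rw [h2, psi_eq hP]
  have h3 := mul_le_mul_of_nonneg_left (mul_le_mul_of_nonneg_left h1 hp0)
    (sub_nonneg.2 (one_le_gridFactor hP))
  nlinarith

/-- Supplying all energy from the grid costs at most `gridFactor` times the cost of any mix. -/
lemma grid_le_psi {P : DCParams} (hP : P.Valid) {p e : ℝ} (hp0 : 0 ≤ p) (hp : p ≤ P.Pmax)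
    (he : 0 ≤ e) (y : ℕ) : p * e ≤ P.gridFactor * P.psi y p e := by
  have h := slack_le hP (e := fun _ => e) (t := 0) hp0 he le_rfl (y := y)
  have h0 : 0 ≤ ∑ i ∈ Finset.range y,
      ((P.gridFactor - 1) * (p * P.subDemand (fun _ => e) i 0)
      + P.gridFactor * ((if i < y then 1 else 0)
        * (P.cm - max 0 (p - P.co) * P.subDemand (fun _ => e) i 0))) := by
    refine Finset.sum_nonneg fun i hi => ?_
    rw [if_pos (Finset.mem_range.1 hi)]
    have := grid_le_onsite hP hp0 hp (subDemand_nonneg hP (fun _ => e) i 0) (subDemand_le _ i 0)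
    linarith
  linarith

/-- Running the generators in `s` costs at most the pure grid cost minus their individual cost
differences. -/
lemma psi_le_sub_costDiff {P : DCParams} (hP : P.Valid) {p e : ℕ → ℝ} {t : ℕ} (he : 0 ≤ e t)
    (n : ℕ) (y : ℕ → ℕ) (hy : ∀ i, y i = 0 ∨ y i = 1) :
    P.psi (∑ i ∈ Finset.range n, y i) (p t) (e t)
      ≤ p t * e t - ∑ i ∈ Finset.range n, P.costDiff p e i t * y i := by
  rw [psi_eq hP]
  set s := (Finset.range n).filter (fun i => y i = 1)
  have h1 : ∑ i ∈ Finset.range n, y i = s.card := by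
    rw [Finset.card_filter]
    exact Finset.sum_congr rfl fun i _ => by rcases hy i with h | h <;> simp [h]
  have h2 : ∑ i ∈ Finset.range n, P.costDiff p e i t * y i = ∑ i ∈ s, P.costDiff p e i t := by
    rw [Finset.sum_filter]
    exact Finset.sum_congr rfl fun i _ => by rcases hy i with h | h <;> simp [h]
  rw [h1, h2, Finset.sum_congr rfl fun i _ => costDiff_eq hP p e i t, Finset.sum_sub_distrib,
    ← Finset.mul_sum, Finset.sum_const, nsmul_eq_mul]
  have := mul_le_mul_of_nonneg_left (sum_subDemand_finset_le hP he s) (le_max_left 0 (p t - P.co))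
  linarith

end DCParams

/-! ### Switching costs of integer sequences -/

/-- The total upward variation `∑ [y(u) - y(u-1)]⁺` over the slots `1, …, t`. -/
noncomputable def upSwitches (y : ℕ → ℕ) (t : ℕ) : ℝ :=
  ∑ u ∈ Finset.Icc 1 t, max 0 ((y u : ℝ) - (y (u - 1) : ℝ))

@[simp] lemma upSwitches_zero (y : ℕ → ℕ) : upSwitches y 0 = 0 := by simp [upSwitches]

lemma upSwitches_succ (y : ℕ → ℕ) (t : ℕ) :
    upSwitches y (t + 1) = upSwitches y t + max 0 ((y (t + 1) : ℝ) - (y t : ℝ)) := by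
  unfold upSwitches
  rw [Finset.sum_Icc_succ_top (by omega)]
  simp

lemma upSwitches_nonneg (y : ℕ → ℕ) (t : ℕ) : 0 ≤ upSwitches y t :=
  Finset.sum_nonneg fun _ _ => le_max_left _ _

lemma upSwitches_succ_of_le {y : ℕ → ℕ} {t : ℕ} (h : y (t + 1) ≤ y t) :
    upSwitches y (t + 1) = upSwitches y t := by
  have : (y (t + 1) : ℝ) ≤ y t := by exact_mod_cast h
  rw [upSwitches_succ, max_eq_left (by linarith), add_zero]

lemma upSwitches_succ_of_on {y : ℕ → ℕ} {t : ℕ} (h : y t = 0) (h' : y (t + 1) = 1) :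
    upSwitches y (t + 1) = upSwitches y t + 1 := by
  rw [upSwitches_succ, h, h']; simp

/-- Switching the sum of several sequences costs at most switching them separately. -/
lemma upSwitches_sum_le (n : ℕ) (y : ℕ → ℕ → ℕ) (t : ℕ) :
    upSwitches (fun u => ∑ i ∈ Finset.range n, y i u) t
      ≤ ∑ i ∈ Finset.range n, upSwitches (y i) t := by
  unfold upSwitches
  rw [Finset.sum_comm]
  refine Finset.sum_le_sum fun u _ => max_le (Finset.sum_nonneg fun _ _ => le_max_left _ _) ?_
  push_cast
  rw [← Finset.sum_sub_distrib]
  exact Finset.sum_le_sum fun _ _ => le_max_right _ _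

/-- Unit `i` is on when more than `i` units are on: the level sets of an integer sequence. -/
def levelSeq (x : ℕ → ℕ) (i t : ℕ) : ℕ := if i < x t then 1 else 0

lemma levelSeq_eq (x : ℕ → ℕ) (i t : ℕ) : levelSeq x i t = 0 ∨ levelSeq x i t = 1 := by
  unfold levelSeq; split_ifs <;> simp

/-- Switching the level sets separately costs no more than switching the sequence. -/
lemma sum_upSwitches_levelSeq_le (n : ℕ) (x : ℕ → ℕ) (t : ℕ) :
    ∑ i ∈ Finset.range n, upSwitches (levelSeq x i) t ≤ upSwitches x t := by
  unfold upSwitches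
  rw [Finset.sum_comm]
  refine Finset.sum_le_sum fun u _ => ?_
  have key : ∀ a b : ℕ, ∑ i ∈ Finset.range n,
      max 0 (((if i < a then 1 else 0 : ℕ) : ℝ) - ((if i < b then 1 else 0 : ℕ) : ℝ))
        ≤ max 0 ((a : ℝ) - b) := by
    intro a b
    have h1 : ∀ i ∈ Finset.range n,
        max 0 (((if i < a then 1 else 0 : ℕ) : ℝ) - ((if i < b then 1 else 0 : ℕ) : ℝ))
          = if i ∈ Finset.Ico b a then 1 else 0 := by
      intro i _
      by_cases h : i < a <;> by_cases h' : i < b <;> simp [h, h']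
    rw [Finset.sum_congr rfl h1, ← Finset.sum_filter, Finset.sum_const, nsmul_eq_mul, mul_one]
    have h2 : ((Finset.range n).filter (· ∈ Finset.Ico b a)).card ≤ a - b := by
      rw [← Nat.card_Ico b a]
      exact Finset.card_le_card fun i hi => (Finset.mem_filter.1 hi).2
    rcases le_total b a with hab | hab
    · refine (Nat.cast_le.2 h2).trans ?_
      rw [Nat.cast_sub hab]; exact le_max_right _ _
    · rw [Nat.sub_eq_zero_of_le hab] at h2
      exact (by exact_mod_cast h2 : _ ≤ (0 : ℝ)).trans (le_max_left _ _)
  exact key _ _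

/-! ### A single server under GCSR -/

namespace DCInput

/-- The cost of keeping server `i` on during slot `t`, at the grid price. -/
def idleCost (I : DCInput) (i t : ℕ) : ℝ := I.p t * I.subPower i t

lemma gcsrState_succ_busy {I : DCInput} {P : DCParams} {w i t : ℕ}
    (h : 0 < I.subWorkload i (t + 1)) : I.gcsrState P w i (t + 1) = (1, 0) := by
  simp [gcsrState, h]

lemma gcsrState_succ_off {I : DCInput} {P : DCParams} {w i t : ℕ}
    (h : ¬ 0 < I.subWorkload i (t + 1))
    (h' : I.GcsrOff P w i (t + 1) (I.gcsrState P w i t).2) :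
    I.gcsrState P w i (t + 1) = (0, 0) := by
  simp [gcsrState, h, h']

lemma gcsrState_succ_stay {I : DCInput} {P : DCParams} {w i t : ℕ}
    (h : ¬ 0 < I.subWorkload i (t + 1))
    (h' : ¬ I.GcsrOff P w i (t + 1) (I.gcsrState P w i t).2) :
    I.gcsrState P w i (t + 1) = ((I.gcsrState P w i t).1,
      (I.gcsrState P w i t).2 + I.idleCost i (t + 1) * (I.gcsrState P w i t).1) := by
  simp [gcsrState, h, h', idleCost]

lemma gcsrState_fst (I : DCInput) (P : DCParams) (w i t : ℕ) :
    (I.gcsrState P w i t).1 = 0 ∨ (I.gcsrState P w i t).1 = 1 := by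
  induction t with
  | zero => simp [gcsrState]
  | succ t ih =>
    by_cases h : 0 < I.subWorkload i (t + 1)
    · rw [gcsrState_succ_busy h]; simp
    by_cases h' : I.GcsrOff P w i (t + 1) (I.gcsrState P w i t).2
    · rw [gcsrState_succ_off h h']; simp
    · rw [gcsrState_succ_stay h h']; simpa using ih

lemma gcsrState_snd_of_off (I : DCInput) (P : DCParams) (w i t : ℕ)
    (h0 : (I.gcsrState P w i t).1 = 0) : (I.gcsrState P w i t).2 = 0 := by
  induction t with
  | zero => simp [gcsrState]
  | succ t ih =>
    by_cases h : 0 < I.subWorkload i (t + 1)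
    · rw [gcsrState_succ_busy h] at h0; simp at h0
    by_cases h' : I.GcsrOff P w i (t + 1) (I.gcsrState P w i t).2
    · rw [gcsrState_succ_off h h']
    · rw [gcsrState_succ_stay h h'] at h0 ⊢
      simp only at h0
      simp [h0, ih h0]

lemma gcsrState_snd_nonneg {I : DCInput} {P : DCParams} {w i : ℕ}
    (hc : ∀ t, 1 ≤ t → 0 ≤ I.idleCost i t) (t : ℕ) : 0 ≤ (I.gcsrState P w i t).2 := by
  induction t with
  | zero => simp [gcsrState]
  | succ t ih =>
    by_cases h : 0 < I.subWorkload i (t + 1)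
    · rw [gcsrState_succ_busy h]
    by_cases h' : I.GcsrOff P w i (t + 1) (I.gcsrState P w i t).2
    · rw [gcsrState_succ_off h h']
    · rw [gcsrState_succ_stay h h']
      exact add_nonneg ih (mul_nonneg (hc _ (by omega)) (Nat.cast_nonneg _))

lemma exists_isLeast_of_mem {S : Set ℕ} {s : ℕ} (h : s ∈ S) : ∃ m, IsLeast S m :=
  ⟨sInf S, Nat.sInf_mem ⟨s, h⟩, fun _ hx => Nat.sInf_le hx⟩

/-- A server without workload that is not turned off has not yet reached the break-even point. -/
lemma add_idleCost_lt_of_not_off {I : DCInput} {P : DCParams} {w i t : ℕ} {C : ℝ}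
    (h : ¬ 0 < I.subWorkload i t) (h' : ¬ I.GcsrOff P w i t C) :
    C + I.idleCost i t < P.betaS := by
  by_contra hlt
  refine h' ⟨t, ⟨⟨⟨le_rfl, by omega⟩, ?_⟩, fun s hs => hs.1.1⟩, ?_⟩
  · simpa [idleCost] using hlt
  · rintro u ⟨h1, h2⟩
    rwa [le_antisymm h2 h1]

/-- A server that is not turned off at `t`, although no workload is ahead in the window, or although
it is turned off in the next slot, sees that the break-even point lies beyond the window. -/
lemma window_lt_of_not_off {I : DCInput} {P : DCParams} {w i t : ℕ} {C : ℝ}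
    (h : ¬ 0 < I.subWorkload i t) (h' : ¬ I.GcsrOff P w i t C)
    (hor : I.GcsrOff P w i (t + 1) (C + I.idleCost i t) ∨
      ∀ u ∈ Set.Icc t (t + w), ¬ 0 < I.subWorkload i u) :
    C + ∑ u ∈ Finset.Icc t (t + w), I.idleCost i u < P.betaS := by
  by_contra hge
  obtain ⟨s, hs⟩ := exists_isLeast_of_mem (S := {s | s ∈ Set.Icc t (t + w) ∧
      P.betaS ≤ C + ∑ u ∈ Finset.Icc t s, I.p u * I.subPower i u}) (s := t + w)
      ⟨⟨by omega, le_rfl⟩, not_lt.1 hge⟩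
  have hts : t < s := by
    rcases hs.1.1.1.lt_or_eq with h1 | h1
    · exact h1
    · exfalso
      have h2 := hs.1.2
      rw [← h1, Finset.Icc_self, Finset.sum_singleton] at h2
      exact absurd (add_idleCost_lt_of_not_off h h') (not_lt.2 h2)
  refine h' ⟨s, hs, ?_⟩
  rcases hor with ⟨s', hs', hb⟩ | hb
  · have hsplit : ∀ r, t ≤ r → ∑ u ∈ Finset.Icc t r, I.p u * I.subPower i u
        = I.idleCost i t + ∑ u ∈ Finset.Icc (t + 1) r, I.p u * I.subPower i u := fun r hr => by
      rw [← Finset.insert_Icc_add_one_left_eq_Icc hr, Finset.sum_insert (by simp)]; rfl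
    have h1 : s' ≤ s := by
      refine hs'.2 ⟨⟨by omega, ?_⟩, ?_⟩
      · have := hs.1.1.2; omega
      · have := hs.1.2
        rw [hsplit s hts.le] at this
        linarith
    have h2 : s ≤ s' := by
      refine hs.2 ⟨⟨?_, ?_⟩, ?_⟩
      · have := hs'.1.1.1; omega
      · exact h1.trans hs.1.1.2
      · have := hs'.1.2
        rw [hsplit s' (by have := hs'.1.1.1; omega)]
        linarith
    rintro u ⟨hu1, hu2⟩
    rcases hu1.lt_or_eq with h3 | h3
    · exact hb u ⟨h3, hu2.trans h2⟩
    · rwa [← h3]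
  · exact fun u hu => hb u ⟨hu.1, hu.2.trans hs.1.1.2⟩

/-- A server `i` that is on costs at least `δ ≥ 0` in each slot. -/
structure IdleBound (I : DCInput) (i : ℕ) (δ : ℝ) : Prop where
  nonneg : 0 ≤ δ
  le : ∀ t, 1 ≤ t → δ ≤ I.idleCost i t

lemma IdleBound.cost_nonneg {I : DCInput} {i : ℕ} {δ : ℝ} (h : I.IdleBound i δ) (t : ℕ)
    (ht : 1 ≤ t) : 0 ≤ I.idleCost i t := h.nonneg.trans (h.le t ht)

lemma IdleBound.mul_le_sum {I : DCInput} {i : ℕ} {δ : ℝ} (h : I.IdleBound i δ) {t : ℕ}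
    (ht : 1 ≤ t) (n : ℕ) : n * δ ≤ ∑ u ∈ Finset.Ico t (t + n), I.idleCost i u := by
  have := Finset.card_nsmul_le_sum (Finset.Ico t (t + n)) (fun u => I.idleCost i u) δ
    fun u hu => h.le u (ht.trans (Finset.mem_Ico.1 hu).1)
  simpa using this

lemma add_le_of_window_lt {I : DCInput} {P : DCParams} {w i t : ℕ} {C δ : ℝ}
    (hI : I.IdleBound i δ)
    (h : C + ∑ u ∈ Finset.Icc t (t + w), I.idleCost i u < P.betaS) :
    C + I.idleCost i t + w * δ < P.betaS := by
  have h1 : ∑ u ∈ Finset.Icc t (t + w), I.idleCost i u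
      = I.idleCost i t + ∑ u ∈ Finset.Ico (t + 1) (t + 1 + w), I.idleCost i u := by
    rw [← Finset.insert_Icc_add_one_left_eq_Icc (by omega : t ≤ t + w),
      Finset.sum_insert (by simp)]
    congr 2
    ext u; simp; omega
  have h2 := hI.mul_le_sum (t := t + 1) (by omega) w
  linarith

/-- A server that is on has just had workload, or it has been kept on. -/
lemma on_cases {I : DCInput} {P : DCParams} {w i t : ℕ} (h1 : (I.gcsrState P w i t).1 = 1) :
    (I.gcsrState P w i t).2 = 0 ∨ ∃ C, 1 ≤ t ∧ ¬ 0 < I.subWorkload i t ∧ ¬ I.GcsrOff P w i t C ∧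
      (I.gcsrState P w i t).2 = C + I.idleCost i t := by
  cases t with
  | zero => simp [gcsrState] at h1
  | succ t =>
    by_cases h : 0 < I.subWorkload i (t + 1)
    · rw [gcsrState_succ_busy h]; simp
    by_cases h' : I.GcsrOff P w i (t + 1) (I.gcsrState P w i t).2
    · rw [gcsrState_succ_off h h'] at h1; simp at h1
    · rw [gcsrState_succ_stay h h'] at h1
      refine Or.inr ⟨(I.gcsrState P w i t).2, by omega, h, h', ?_⟩
      rw [gcsrState_succ_stay h h']
      simp only at h1
      simp [h1]

lemma snd_lt_of_on {I : DCInput} {P : DCParams} (hP : P.Valid) {w i t : ℕ}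
    (h1 : (I.gcsrState P w i t).1 = 1) : (I.gcsrState P w i t).2 < P.betaS := by
  rcases on_cases h1 with h | ⟨C, -, h2, h3, h4⟩
  · rw [h]; exact hP.betaS_pos
  · rw [h4]; exact add_idleCost_lt_of_not_off h2 h3

/-- A server that gets turned off, or that sees no more workload, has idled for at most
`[β_s - w δ]⁺`. -/
lemma snd_le_of_off {I : DCInput} {P : DCParams} {w i t : ℕ} {δ : ℝ}
    (hI : I.IdleBound i δ) (h1 : (I.gcsrState P w i t).1 = 1)
    (hor : I.GcsrOff P w i (t + 1) (I.gcsrState P w i t).2 ∨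
      ∀ u, t < u → ¬ 0 < I.subWorkload i u) :
    (I.gcsrState P w i t).2 ≤ max 0 (P.betaS - w * δ) := by
  rcases on_cases h1 with h | ⟨C, h0, h2, h3, h4⟩
  · rw [h]; exact le_max_left _ _
  · have h5 := add_le_of_window_lt hI (window_lt_of_not_off h2 h3 (by
      rcases hor with h5 | h5
      · left; rwa [← h4]
      · right
        rintro u ⟨hu1, -⟩
        rcases hu1.lt_or_eq with h6 | h6
        · exact h5 u h6
        · rwa [← h6]))
    rw [h4]
    exact le_max_of_le_right (by linarith)

/-- The cost of server `i` for a sequence `x` of on/off states, at grid prices. -/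
noncomputable def serverCost (I : DCInput) (P : DCParams) (i : ℕ) (x : ℕ → ℕ) (t : ℕ) : ℝ :=
  ∑ u ∈ Finset.Icc 1 t, I.idleCost i u * x u + P.betaS * upSwitches x t

lemma serverCost_succ (I : DCInput) (P : DCParams) (i : ℕ) (x : ℕ → ℕ) (t : ℕ) :
    I.serverCost P i x (t + 1) = I.serverCost P i x t + I.idleCost i (t + 1) * x (t + 1)
      + P.betaS * max 0 ((x (t + 1) : ℝ) - (x t : ℝ)) := by
  unfold serverCost
  rw [Finset.sum_Icc_succ_top (by omega), upSwitches_succ]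
  ring

/-- The amortized comparison of a server under GCSR with an arbitrary sequence `o`, after slot `t`.
Here `κ` bounds the idling cost before the server is turned off, and `K = 1 + κ / β_s` is the
ratio. While the server is off, `S` is the idling cost that it would have accumulated since its
last workload: it has reached `β_s`, or will do so before the next workload. -/
def ServerInvariant (I : DCInput) (P : DCParams) (w i : ℕ) (o : ℕ → ℕ) (κ K : ℝ) (t : ℕ) : Prop :=
  let A := I.serverCost P i (fun u => (I.gcsrState P w i u).1) t
  let C := (I.gcsrState P w i t).2
  ((I.gcsrState P w i t).1 = 1 ∧
    (o t = 1 → A ≤ K * I.serverCost P i o t - κ - (K - 1) * C) ∧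
    (o t = 0 → A ≤ K * I.serverCost P i o t - κ + C)) ∨
  ((I.gcsrState P w i t).1 = 0 ∧ ∃ S, 0 ≤ S ∧
    (P.betaS ≤ S ∨ ∃ s, t < s ∧ P.betaS ≤ S + ∑ u ∈ Finset.Icc (t + 1) s, I.idleCost i u ∧
      ∀ u ∈ Set.Icc (t + 1) s, ¬ 0 < I.subWorkload i u) ∧
    (o t = 1 → A ≤ K * I.serverCost P i o t - K * min S P.betaS) ∧
    (o t = 0 → A ≤ K * I.serverCost P i o t))

lemma serverInvariant_off_step {I : DCInput} {P : DCParams} {w i t : ℕ} {o : ℕ → ℕ} {κ K S : ℝ}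
    (hP : P.Valid) (hK : 1 ≤ K) (hc : 0 ≤ I.idleCost i (t + 1)) (hS : 0 ≤ S)
    (ho : o t = 0 ∨ o t = 1) (hoff : (I.gcsrState P w i (t + 1)).1 = 0)
    (hS' : P.betaS ≤ S ∨ ∃ s, t < s ∧ P.betaS ≤ S + ∑ u ∈ Finset.Icc (t + 1) s, I.idleCost i u ∧
      ∀ u ∈ Set.Icc (t + 1) s, ¬ 0 < I.subWorkload i u)
    (h1 : o t = 1 → I.serverCost P i (fun u => (I.gcsrState P w i u).1) t
      ≤ K * I.serverCost P i o t - K * min S P.betaS)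
    (h0 : o t = 0 → I.serverCost P i (fun u => (I.gcsrState P w i u).1) t
      ≤ K * I.serverCost P i o t) :
    I.ServerInvariant P w i o κ K (t + 1) := by
  have hβ := hP.betaS_pos
  right
  refine ⟨hoff, S + I.idleCost i (t + 1), by linarith, ?_, ?_, ?_⟩
  · rcases hS' with h | ⟨s, hs, hs1, hs2⟩
    · left; linarith
    · rw [← Finset.insert_Icc_add_one_left_eq_Icc (by omega : t + 1 ≤ s),
        Finset.sum_insert (by simp), ← add_assoc] at hs1
      rcases (by omega : t + 1 ≤ s).lt_or_eq with h | h
      · exact Or.inr ⟨s, h, hs1, fun u hu => hs2 u ⟨by have := hu.1; omega, hu.2⟩⟩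
      · left
        rw [← h, Finset.Icc_eq_empty (by omega), Finset.sum_empty, add_zero] at hs1
        exact hs1
  all_goals
    intro ho1
    rw [serverCost_succ, serverCost_succ, hoff, ho1]
    have hmax : max (0 : ℝ) (((0 : ℕ) : ℝ) - ((I.gcsrState P w i t).1 : ℝ)) = 0 :=
      max_eq_left (by simp)
    rw [hmax]
  · have hmin : min (S + I.idleCost i (t + 1)) P.betaS ≤ min S P.betaS + I.idleCost i (t + 1) := by
      rcases le_total S P.betaS with h | h
      · rw [min_eq_left h]; exact min_le_left _ _
      · rw [min_eq_right h]; exact (min_le_right _ _).trans (by linarith)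
    have hmin' : min (S + I.idleCost i (t + 1)) P.betaS ≤ P.betaS := min_le_right _ _
    have := mul_le_mul_of_nonneg_left hmin (by linarith : 0 ≤ K)
    have := mul_le_mul_of_nonneg_left hmin' (by linarith : 0 ≤ K)
    have := mul_nonneg (by linarith : 0 ≤ K) hc
    rcases ho with h | h
    · have := h0 h
      rw [h]; norm_num; nlinarith
    · have := h1 h
      rw [h]; norm_num; nlinarith
  · have hKm : 0 ≤ K * min S P.betaS := mul_nonneg (by linarith) (le_min hS hβ.le)
    rcases ho with h | h
    · have := h0 h
      rw [h]; norm_num; nlinarith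
    · have := h1 h
      rw [h]; norm_num; nlinarith

lemma serverInvariant {I : DCInput} {P : DCParams} (hP : P.Valid) {w i T : ℕ} {o : ℕ → ℕ}
    {κ K δ : ℝ} (hI : I.IdleBound i δ) (hκ : κ = max 0 (P.betaS - w * δ))
    (hK : K * P.betaS = P.betaS + κ) (ho : ∀ t, o t = 0 ∨ o t = 1) (ho0 : o 0 = 0)
    (hob : ∀ t, 1 ≤ t → t ≤ T → 0 < I.subWorkload i t → o t = 1) :
    ∀ t ≤ T, I.ServerInvariant P w i o κ K t := by
  have hβ := hP.betaS_pos
  have hκ0 : 0 ≤ κ := hκ ▸ le_max_left _ _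
  have hK1 : 1 ≤ K := by
    by_contra h
    nlinarith
  intro t
  induction t with
  | zero =>
    intro _
    right
    refine ⟨by simp [gcsrState], P.betaS, hβ.le, Or.inl le_rfl, ?_, ?_⟩
    · simp [ho0]
    · simp [serverCost]
  | succ t ih =>
    intro ht
    have ih := ih (by omega)
    have hc := hI.cost_nonneg (t + 1) (by omega)
    have hKc := mul_le_mul_of_nonneg_right hK1 hc
    by_cases hb : 0 < I.subWorkload i (t + 1)
    · -- workload arrives: both are on, and the accumulated idling cost is reset
      have hst := gcsrState_succ_busy (P := P) (w := w) hb
      have ho1 := hob (t + 1) (by omega) ht hb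
      left
      rw [hst]
      refine ⟨rfl, fun _ => ?_, fun h => by omega⟩
      rw [serverCost_succ, serverCost_succ, hst, ho1]
      rcases ih with ⟨hx, h1, h0⟩ | ⟨hx, S, hS, hS', h1, h0⟩
      · rw [hx]
        have hC := snd_lt_of_on hP hx
        have hC0 := gcsrState_snd_nonneg (P := P) (w := w) hI.cost_nonneg t
        have := mul_nonneg (by linarith : 0 ≤ K - 1) hC0
        rcases ho t with h | h
        · have := h0 h
          rw [h]; norm_num; nlinarith
        · have := h1 h
          rw [h]; norm_num; nlinarith
      · rw [hx]
        have hSβ : P.betaS ≤ S := by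
          rcases hS' with h | ⟨s, hs, -, hs2⟩
          · exact h
          · exact absurd hb (hs2 (t + 1) ⟨le_rfl, hs⟩)
        rw [min_eq_right hSβ] at h1
        rcases ho t with h | h
        · have := h0 h
          rw [h]; norm_num; nlinarith
        · have := h1 h
          rw [h]; norm_num; nlinarith
    by_cases hoff : I.GcsrOff P w i (t + 1) (I.gcsrState P w i t).2
    · have hst := gcsrState_succ_off hb hoff
      rcases ih with ⟨hx, h1, h0⟩ | ⟨hx, S, hS, hS', h1, h0⟩
      · have hC0 := gcsrState_snd_nonneg (P := P) (w := w) hI.cost_nonneg t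
        have hCκ : (I.gcsrState P w i t).2 ≤ κ := hκ ▸ snd_le_of_off hI hx (Or.inl hoff)
        have hCβ := snd_lt_of_on hP hx
        refine serverInvariant_off_step hP hK1 hc hC0 (ho t) (by rw [hst]) ?_ ?_ ?_
        · obtain ⟨s, hs, hs'⟩ := hoff
          exact Or.inr ⟨s, by have := hs.1.1.1; omega, hs.1.2, hs'⟩
        · intro h
          rw [min_eq_left hCβ.le]
          have := h1 h
          linarith
        · intro h
          have := h0 h
          linarith
      · exact serverInvariant_off_step hP hK1 hc hS (ho t) (by rw [hst]) hS' h1 h0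
    · have hst := gcsrState_succ_stay hb hoff
      rcases ih with ⟨hx, h1, h0⟩ | ⟨hx, S, hS, hS', h1, h0⟩
      · have hCβ := snd_lt_of_on hP hx
        have hC0 := gcsrState_snd_nonneg (P := P) (w := w) hI.cost_nonneg t
        have hKC := mul_le_mul_of_nonneg_left hCβ.le (by linarith : 0 ≤ K)
        have hK1C := mul_nonneg (by linarith : 0 ≤ K - 1) hC0
        left
        rw [hst, hx]
        refine ⟨rfl, fun ho1 => ?_, fun ho1 => ?_⟩
        all_goals
          rw [serverCost_succ, serverCost_succ, hst, hx, ho1]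
          rcases ho t with h | h
          · have := h0 h
            rw [h]; norm_num; nlinarith
          · have := h1 h
            rw [h]; norm_num; nlinarith
      · exact serverInvariant_off_step hP hK1 hc hS (ho t)
          (by rw [hst]; exact hx) hS' h1 h0

/-- GCSR is `1 + [β_s - w δ]⁺ / β_s`-competitive on every single server. -/
lemma serverCost_gcsr_le {I : DCInput} {P : DCParams} (hP : P.Valid) {w i T : ℕ} {o : ℕ → ℕ}
    {κ K δ : ℝ} (hI : I.IdleBound i δ) (hκ : κ = max 0 (P.betaS - w * δ))
    (hK : K * P.betaS = P.betaS + κ) (ho : ∀ t, o t = 0 ∨ o t = 1) (ho0 : o 0 = 0)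
    (hob : ∀ t, 1 ≤ t → t ≤ T → 0 < I.subWorkload i t → o t = 1)
    (hT : ∀ t, T < t → ¬ 0 < I.subWorkload i t) :
    I.serverCost P i (fun u => (I.gcsrState P w i u).1) T ≤ K * I.serverCost P i o T := by
  have hβ := hP.betaS_pos
  have hκ0 : 0 ≤ κ := hκ ▸ le_max_left _ _
  have hK1 : 1 ≤ K := by
    by_contra h
    nlinarith
  rcases serverInvariant hP hI hκ hK ho ho0 hob T le_rfl with ⟨hx, h1, h0⟩ | ⟨hx, S, hS, -, h1, h0⟩
  · have hC : (I.gcsrState P w i T).2 ≤ κ := hκ ▸ snd_le_of_off hI hx (Or.inr hT)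
    have hC0 := gcsrState_snd_nonneg (P := P) (w := w) hI.cost_nonneg T
    have hK1C := mul_nonneg (by linarith : 0 ≤ K - 1) hC0
    rcases ho T with h | h
    · linarith [h0 h]
    · linarith [h1 h]
  · rcases ho T with h | h
    · exact h0 h
    · have := mul_nonneg (by linarith : 0 ≤ K) (le_min hS hβ.le)
      linarith [h1 h]

/-- When the window reaches the break-even point, a server idles only where this is cheaper than a
new start: keeping `o` on in these slots costs at most what `o` spends on switching. -/
lemma sum_idle_le_switching {I : DCInput} {P : DCParams} (hP : P.Valid) {w i T : ℕ} {o : ℕ → ℕ}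
    {δ : ℝ} (hI : I.IdleBound i δ) (hw : P.betaS ≤ w * δ) (ho : ∀ t, o t = 0 ∨ o t = 1)
    (hob : ∀ t, 1 ≤ t → t ≤ T → 0 < I.subWorkload i t → o t = 1)
    (hT : ∀ t, T < t → ¬ 0 < I.subWorkload i t) :
    ∑ u ∈ Finset.Icc 1 T, I.idleCost i u * ((I.gcsrState P w i u).1 * (1 - o u))
      ≤ P.betaS * upSwitches o T := by
  have hβ := hP.betaS_pos
  have hκ : max 0 (P.betaS - w * δ) = 0 := max_eq_left (by linarith)
  have key : ∀ t ≤ T, ∑ u ∈ Finset.Icc 1 t, I.idleCost i u * ((I.gcsrState P w i u).1 * (1 - o u))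
      ≤ P.betaS * upSwitches o t + if o t = 0 then (I.gcsrState P w i t).2 else 0 := by
    intro t
    induction t with
    | zero => simp [gcsrState]
    | succ t ih =>
      intro ht
      have ih := ih (by omega)
      have hc := hI.cost_nonneg (t + 1) (by omega)
      have hC0 := gcsrState_snd_nonneg (P := P) (w := w) hI.cost_nonneg t
      have hC0' := gcsrState_snd_nonneg (P := P) (w := w) hI.cost_nonneg (t + 1)
      have hCβ : (I.gcsrState P w i t).2 ≤ P.betaS := by
        rcases I.gcsrState_fst P w i t with h | h
        · rw [gcsrState_snd_of_off I P w i t h]; exact hβ.le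
        · exact (snd_lt_of_on hP h).le
      rw [Finset.sum_Icc_succ_top (by omega)]
      rcases ho (t + 1) with ho1 | ho1
      · rw [upSwitches_succ_of_le (by omega), ho1, if_pos rfl]
        have ih' : ∑ u ∈ Finset.Icc 1 t, I.idleCost i u * ((I.gcsrState P w i u).1 * (1 - o u))
            ≤ P.betaS * upSwitches o t + (I.gcsrState P w i t).2 := by
          split_ifs at ih <;> linarith
        by_cases hb : 0 < I.subWorkload i (t + 1)
        · exact absurd (hob (t + 1) (by omega) ht hb) (by omega)
        by_cases hoff : I.GcsrOff P w i (t + 1) (I.gcsrState P w i t).2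
        · rw [gcsrState_succ_off hb hoff]
          rcases I.gcsrState_fst P w i t with h | h
          · rw [gcsrState_snd_of_off I P w i t h] at ih'
            simpa using ih'
          · have := snd_le_of_off hI h (Or.inl hoff)
            rw [hκ] at this
            simp only [Nat.cast_zero, zero_mul, mul_zero, add_zero]
            linarith
        · rw [gcsrState_succ_stay hb hoff]
          simp only [Nat.cast_zero, sub_zero, mul_one]
          linarith
      · rw [ho1, if_neg one_ne_zero]
        simp only [Nat.cast_one, sub_self, mul_zero, add_zero]
        rcases ho t with h | h
        · rw [upSwitches_succ_of_on h ho1]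
          rw [if_pos h] at ih
          linarith
        · rw [upSwitches_succ_of_le (by omega)]
          rw [if_neg (by omega)] at ih
          linarith
  refine (key T le_rfl).trans ?_
  have hC : (I.gcsrState P w i T).2 ≤ 0 := by
    rcases I.gcsrState_fst P w i T with h | h
    · rw [gcsrState_snd_of_off I P w i T h]
    · have := snd_le_of_off hI h (Or.inr hT)
      rwa [hκ] at this
  split_ifs <;> linarith

end DCInput

/-! ### A single generator under CHASE -/

namespace DCParams

/-- `s` is the first slot after `t` where `R_i` is `0` or `-betaG`. -/
def NextHit (P : DCParams) (p e : ℕ → ℝ) (i t s : ℕ) : Prop :=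
  t < s ∧ (P.cumDiff p e i s = 0 ∨ P.cumDiff p e i s = -P.betaG) ∧
    ∀ u, t < u → u < s → P.cumDiff p e i u ≠ 0 ∧ P.cumDiff p e i u ≠ -P.betaG

section

variable {P : DCParams} {p e : ℕ → ℝ} {v i t s : ℕ}

lemma NextHit.unique {s' : ℕ} (h : P.NextHit p e i t s) (h' : P.NextHit p e i t s') : s = s' := by
  rcases lt_trichotomy s s' with hlt | heq | hgt
  · have := h'.2.2 s h.1 hlt
    rcases h.2.1 with h1 | h1
    · exact absurd h1 this.1
    · exact absurd h1 this.2
  · exact heq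
  · have := h.2.2 s' h'.1 hgt
    rcases h'.2.1 with h1 | h1
    · exact absurd h1 this.1
    · exact absurd h1 this.2

lemma NextHit.succ (h : P.NextHit p e i t s) (hs : t + 1 < s) : P.NextHit p e i (t + 1) s :=
  ⟨hs, h.2.1, fun u hu hu' => h.2.2 u (by omega) hu'⟩

lemma NextHit.pred (h : P.NextHit p e i (t + 1) s) (h0 : P.cumDiff p e i (t + 1) ≠ 0)
    (h1 : P.cumDiff p e i (t + 1) ≠ -P.betaG) : P.NextHit p e i t s := by
  refine ⟨by have := h.1; omega, h.2.1, fun u hu hu' => ?_⟩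
  rcases (by omega : t + 1 ≤ u).lt_or_eq with h2 | h2
  · exact h.2.2 u h2 hu'
  · subst h2; exact ⟨h0, h1⟩

lemma exists_nextHit (hs : t < s) (h : P.cumDiff p e i s = 0 ∨ P.cumDiff p e i s = -P.betaG) :
    ∃ r ≤ s, P.NextHit p e i t r := by
  obtain ⟨m, hm⟩ := DCInput.exists_isLeast_of_mem
    (S := {r | t < r ∧ (P.cumDiff p e i r = 0 ∨ P.cumDiff p e i r = -P.betaG)}) ⟨hs, h⟩
  refine ⟨m, hm.2 ⟨hs, h⟩, hm.1.1, hm.1.2, fun u hu hu' => ?_⟩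
  by_contra hcon
  have : m ≤ u := hm.2 ⟨hu, by tauto⟩
  omega

lemma firstHit_iff : P.FirstHit p e v i (t + 1) s ↔ P.NextHit p e i t s ∧ s ≤ t + 1 + v := by
  constructor
  · rintro ⟨⟨⟨h1, h2⟩, h3⟩, h4⟩
    refine ⟨⟨h1, h3, fun u hu hu' => ?_⟩, h2⟩
    by_contra hcon
    have : s ≤ u := h4 ⟨⟨hu, by omega⟩, by tauto⟩
    omega
  · rintro ⟨⟨h1, h2, h3⟩, h4⟩
    refine ⟨⟨⟨h1, h4⟩, h2⟩, fun u hu => ?_⟩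
    by_contra hcon
    have := h3 u hu.1.1 (by omega)
    have := hu.2
    tauto

lemma chaseState_succ_of_zero (h : P.NextHit p e i t s) (hs : s ≤ t + 1 + v)
    (h0 : P.cumDiff p e i s = 0) : P.chaseState p e v i (t + 1) = 1 := by
  have hf := firstHit_iff.2 ⟨h, hs⟩
  rw [chaseState, if_neg (not_not.2 ⟨s, hf⟩), if_pos ⟨s, hf, h0⟩]

lemma chaseState_succ_of_neg (h : P.NextHit p e i t s) (hs : s ≤ t + 1 + v)
    (h0 : P.cumDiff p e i s ≠ 0) : P.chaseState p e v i (t + 1) = 0 := by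
  have hf := firstHit_iff.2 ⟨h, hs⟩
  rw [chaseState, if_neg (not_not.2 ⟨s, hf⟩), if_neg]
  rintro ⟨s', hs', h1⟩
  rw [(firstHit_iff.1 hs').1.unique h] at h1
  exact h0 h1

lemma chaseState_succ_of_none (h : ∀ s, P.NextHit p e i t s → t + 1 + v < s) :
    P.chaseState p e v i (t + 1) = P.chaseState p e v i t := by
  rw [chaseState, if_pos]
  rintro ⟨s, hs⟩
  have := h s (firstHit_iff.1 hs).1
  have := (firstHit_iff.1 hs).2
  omega

lemma chaseState_eq (P : DCParams) (p e : ℕ → ℝ) (v i t : ℕ) :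
    P.chaseState p e v i t = 0 ∨ P.chaseState p e v i t = 1 := by
  induction t with
  | zero => simp [chaseState]
  | succ t ih =>
    rw [chaseState]
    split_ifs with h1 h2
    · simp
    · simp
    · exact ih

lemma cumDiff_nonpos (hP : P.Valid) (p e : ℕ → ℝ) (i t : ℕ) : P.cumDiff p e i t ≤ 0 := by
  cases t with
  | zero => simp [cumDiff, hP.betaG_pos.le]
  | succ t => exact min_le_left _ _

lemma neg_betaG_le_cumDiff (hP : P.Valid) (p e : ℕ → ℝ) (i t : ℕ) :
    -P.betaG ≤ P.cumDiff p e i t := by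
  cases t with
  | zero => simp [cumDiff]
  | succ t => exact le_min (by linarith [hP.betaG_pos]) (le_max_left _ _)

lemma cumDiff_succ_le (hP : P.Valid) (h : P.cumDiff p e i (t + 1) ≠ -P.betaG) :
    P.cumDiff p e i (t + 1) ≤ P.cumDiff p e i t + P.costDiff p e i (t + 1) := by
  have hβ := hP.betaG_pos
  rw [cumDiff] at h ⊢
  refine (min_le_right _ _).trans (max_le ?_ le_rfl)
  by_contra hlt
  rw [max_eq_left (by linarith), min_eq_right (by linarith)] at h
  exact h rfl

lemma cumDiff_succ_eq (h0 : P.cumDiff p e i (t + 1) ≠ 0)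
    (h : P.cumDiff p e i (t + 1) ≠ -P.betaG) :
    P.cumDiff p e i (t + 1) = P.cumDiff p e i t + P.costDiff p e i (t + 1) := by
  rw [cumDiff] at h h0 ⊢
  rcases min_choice 0 (max (-P.betaG) (P.cumDiff p e i t + P.costDiff p e i (t + 1))) with h1 | h1
  · exact absurd h1 h0
  · rw [h1] at h ⊢
    rcases max_choice (-P.betaG) (P.cumDiff p e i t + P.costDiff p e i (t + 1)) with h2 | h2
    · exact absurd h2 h
    · exact h2

lemma le_of_cumDiff_succ_eq_zero (hP : P.Valid) (h0 : P.cumDiff p e i (t + 1) = 0) :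
    0 ≤ P.cumDiff p e i t + P.costDiff p e i (t + 1) := by
  by_contra hlt
  have hβ := hP.betaG_pos
  rw [cumDiff] at h0
  have h1 : max (-P.betaG) (P.cumDiff p e i t + P.costDiff p e i (t + 1)) < 0 :=
    max_lt (by linarith) (by linarith)
  rw [min_eq_right h1.le] at h0
  linarith

/-- A generator that is off, and has not just hit `-betaG`, sees no hit of `0` in its window. -/
lemma window_lt_of_off (ht : P.cumDiff p e i t ≠ 0) (hoff : P.chaseState p e v i t = 0)
    (h : P.NextHit p e i t s) (h0 : P.cumDiff p e i s = 0) (ht' : P.cumDiff p e i t ≠ -P.betaG) :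
    t + v < s := by
  by_contra hle
  cases t with
  | zero => simp [cumDiff] at ht'
  | succ t =>
    have := chaseState_succ_of_zero (v := v) (h.pred ht ht') (by omega) h0
    omega

/-- A generator that is on, and has not just hit `0`, sees no hit of `-betaG` in its window. -/
lemma window_lt_of_on (ht : P.cumDiff p e i t ≠ 0) (hon : P.chaseState p e v i t = 1)
    (h : P.NextHit p e i t s) (h0 : P.cumDiff p e i s ≠ 0) (ht' : P.cumDiff p e i t ≠ -P.betaG) :
    t + v < s := by
  by_contra hle
  cases t with
  | zero => simp [cumDiff] at ht'
  | succ t =>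
    have := chaseState_succ_of_neg (v := v) (h.pred ht ht') (by omega) h0
    omega

end

/-- What the states `y` of generator `i` cost in the slots `1, …, t` in excess of grid power. -/
noncomputable def excess (P : DCParams) (p e : ℕ → ℝ) (i : ℕ) (y : ℕ → ℕ) (t : ℕ) : ℝ :=
  P.betaG * upSwitches y t - ∑ u ∈ Finset.Icc 1 t, P.costDiff p e i u * y u

lemma excess_succ (P : DCParams) (p e : ℕ → ℝ) (i : ℕ) (y : ℕ → ℕ) (t : ℕ) :
    P.excess p e i y (t + 1) = P.excess p e i y t
      + P.betaG * max 0 ((y (t + 1) : ℝ) - (y t : ℝ)) - P.costDiff p e i (t + 1) * y (t + 1) := by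
  unfold excess
  rw [Finset.sum_Icc_succ_top (by omega), upSwitches_succ]
  ring

/-- The constants in the analysis of CHASE: the ratio constant `κ`, the rate `lam` at which the
energy demand after an early turn-off is credited, the credit `B` that a generator may owe while it
is on, and the deficit `dfc` that is tolerated per start. In the last two fields, `R` was `-Y` before
the start, and `S` is the total cost difference in the slots from the start until `R` hits `0`. In
the first of them, the hit was seen at the far end of the window, so that there are `v + 1` such
slots; in the second, the generator starts right after a hit of `-betaG`, and there are `j` slots. -/
structure ChaseConstants (P : DCParams) (v : ℕ) (κ lam B dfc : ℝ) : Prop where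
  dfc_nonneg : 0 ≤ dfc
  lam_nonneg : 0 ≤ lam
  lam_le_one : lam ≤ 1
  lam_le : lam ≤ κ / 2
  B_le : B ≤ κ / 2 * P.betaG
  B_le' : B ≤ lam * (v * P.cm)
  start_window : ∀ Y S : ℝ, 0 ≤ Y → Y ≤ P.betaG → Y ≤ S → S ≤ (v + 1) * P.maxDiff →
    κ * P.betaG ≤ κ / 2 * S + (1 + P.cm / P.maxDiff) * (P.betaG - Y) + S + (v + 1) * P.cm + B + dfc
  start_low : ∀ S j : ℝ, 1 ≤ j → P.betaG ≤ S → S ≤ j * P.maxDiff →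
    κ * P.betaG ≤ κ / 2 * S + S + j * P.cm + B + dfc

/-- The account of a generator that is on, or about to be switched on, and whose next hit `s` is a
hit of `0`. It was switched on `j` slots ago, when `R` was `-Y`; `E` is the excess cost including
the startup cost, and `W` the credit. -/
def RiseAccount (P : DCParams) (p e : ℕ → ℝ) (v i : ℕ) (κ W E : ℝ) (t s : ℕ) : Prop :=
  ∃ (Y : ℝ) (j : ℕ), 0 ≤ Y ∧ Y ≤ P.betaG ∧ (j + s = t + v + 1 ∨ Y = P.betaG) ∧
    P.cumDiff p e i t + Y ≤ j * P.maxDiff ∧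
    κ / 2 * (E - P.betaG + P.cumDiff p e i t + Y) + (1 + P.cm / P.maxDiff) * (P.betaG - Y)
      + (P.cumDiff p e i t + Y) + j * P.cm ≤ W

/-- The account of a generator that is off, or about to be switched off, and whose next hit `s` is a
hit of `-betaG`. The first alternative is that of a generator that stops right after a hit of `0`;
otherwise `s` lies at the far end of the window of the slot where it stops, and from then on the
credit grows by at least `lam * cm` plus the increment of `lam * R` in each slot before `s`. -/
def FallAccount (P : DCParams) (p e : ℕ → ℝ) (v i : ℕ) (κ lam B W E : ℝ) (t s : ℕ) : Prop :=
  κ / 2 * E ≤ W ∨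
    κ / 2 * E + lam * (P.cumDiff p e i t + P.betaG) + lam * ((v + t + 1 - s : ℝ) * P.cm) - B ≤ W

/-- The invariant of CHASE, comparing the excess cost `E` with the credit `W`, in each of the four
states: off; on before a hit of `0`; on; off before a hit of `-betaG`. The deficit `dfc` of a start is written
off when `R` hits `0`. -/
def ChaseInvariant (P : DCParams) (p e : ℕ → ℝ) (v i : ℕ) (κ lam B dfc W E : ℝ) (t : ℕ) : Prop :=
  (P.chaseState p e v i t = 0 ∧ P.cumDiff p e i t ≠ 0 ∧
    κ / 2 * E + (1 + P.cm / P.maxDiff) * (P.cumDiff p e i t + P.betaG) ≤ W) ∨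
  (P.chaseState p e v i t = 1 ∧ P.cumDiff p e i t ≠ 0 ∧ ∃ s, P.NextHit p e i t s ∧
    P.cumDiff p e i s = 0 ∧ s ≤ t + v ∧ P.RiseAccount p e v i κ (W - dfc) E t s) ∨
  (P.chaseState p e v i t = 1 ∧ P.cumDiff p e i t ≠ -P.betaG ∧
    κ / 2 * (E + P.cumDiff p e i t + P.betaG) - B ≤ W) ∨
  (P.chaseState p e v i t = 0 ∧ P.cumDiff p e i t ≠ 0 ∧ P.cumDiff p e i t ≠ -P.betaG ∧
    ∃ s, P.NextHit p e i t s ∧ P.cumDiff p e i s ≠ 0 ∧ s ≤ t + v ∧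
    P.FallAccount p e v i κ lam B W E t s)

section

variable {P : DCParams} {p e : ℕ → ℝ} {v i t s : ℕ} {κ lam B dfc W E w : ℝ}

lemma nextHit_self (h : P.cumDiff p e i (t + 1) = 0 ∨ P.cumDiff p e i (t + 1) = -P.betaG) :
    P.NextHit p e i t (t + 1) :=
  ⟨by omega, h, fun u hu hu' => by omega⟩

/-- In a slot before a hit of `0`, the generator is on. -/
lemma chaseInvariant_rise (hP : P.Valid) (hC : P.ChaseConstants v κ lam B dfc)
    (hr : P.costDiff p e i (t + 1) ≤ P.maxDiff) (hs : P.NextHit p e i t s)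
    (hs0 : P.cumDiff p e i s = 0) (hsv : s ≤ t + 1 + v) (h : P.RiseAccount p e v i κ (W - dfc) E t s)
    (hw : P.costDiff p e i (t + 1) + P.cm ≤ w) :
    P.chaseState p e v i (t + 1) = 1 ∧ P.ChaseInvariant p e v i κ lam B dfc (W + w)
      (E - P.costDiff p e i (t + 1)) (t + 1) := by
  have hβ := hP.betaG_pos
  have hκ : 0 ≤ κ / 2 := hC.lam_nonneg.trans hC.lam_le
  have hon := chaseState_succ_of_zero hs hsv hs0
  have hd := hC.dfc_nonneg
  obtain ⟨Y, j, hY0, hY, hj, hR, hW⟩ := h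
  refine ⟨hon, ?_⟩
  rcases (by have := hs.1; omega : t + 1 ≤ s).lt_or_eq with hlt | rfl
  · right; left
    have hnh := hs.2.2 (t + 1) (by omega) hlt
    have heq := cumDiff_succ_eq hnh.1 hnh.2
    refine ⟨hon, hnh.1, s, hs.succ hlt, hs0, hsv, Y, j + 1, hY0, hY, ?_, ?_, ?_⟩
    · rcases hj with hj | hj
      · left; omega
      · exact Or.inr hj
    · rw [heq]; push_cast; linarith
    · rw [heq]; push_cast; linarith
  · right; right; left
    refine ⟨hon, by rw [hs0]; linarith, ?_⟩
    have hge := le_of_cumDiff_succ_eq_zero hP hs0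
    have hS : P.cumDiff p e i t + P.costDiff p e i (t + 1) + Y ≤ (j + 1 : ℝ) * P.maxDiff := by
      linarith
    rw [hs0]
    rcases hj with hj | hj
    · have hjv : (j : ℝ) = v := by exact_mod_cast (by omega : j = v)
      rw [hjv] at hS hW
      have := hC.start_window Y _ hY0 hY (by linarith) hS
      linarith
    · have hj1 : (1 : ℝ) ≤ j + 1 := by have := Nat.cast_nonneg (α := ℝ) j; linarith
      have := hC.start_low _ _ hj1 (by rw [← hj]; linarith) hS
      rw [hj] at hW this
      linarith

/-- In a slot before a hit of `-betaG` that is in the window, the generator is off. -/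
lemma chaseInvariant_fall (hP : P.Valid) (hC : P.ChaseConstants v κ lam B dfc)
    (hs : P.NextHit p e i t s) (hs0 : P.cumDiff p e i s ≠ 0) (hsv : s ≤ t + 1 + v)
    (h : P.FallAccount p e v i κ lam B W E t s) (hw0 : 0 ≤ w)
    (hw : P.cumDiff p e i (t + 1) ≠ -P.betaG → P.costDiff p e i (t + 1) + P.cm ≤ w) :
    P.chaseState p e v i (t + 1) = 0 ∧ P.ChaseInvariant p e v i κ lam B dfc (W + w) E (t + 1) := by
  have hoff := chaseState_succ_of_neg hs hsv hs0
  refine ⟨hoff, ?_⟩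
  rcases (by have := hs.1; omega : t + 1 ≤ s).lt_or_eq with hlt | rfl
  · right; right; right
    have hnh := hs.2.2 (t + 1) (by omega) hlt
    have heq := cumDiff_succ_eq hnh.1 hnh.2
    refine ⟨hoff, hnh.1, hnh.2, s, hs.succ hlt, hs0, hsv, ?_⟩
    rcases h with h | h
    · exact Or.inl (by linarith)
    · right
      have h1 := hw hnh.2
      have h2 : lam * (P.costDiff p e i (t + 1) + P.cm) ≤ w :=
        (mul_le_mul_of_nonneg_left h1 hC.lam_nonneg).trans
          (by nlinarith [hC.lam_le_one])
      rw [heq]; push_cast; linarith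
  · left
    have hR : P.cumDiff p e i (t + 1) = -P.betaG := hs.2.1.resolve_left hs0
    refine ⟨hoff, hs0, ?_⟩
    rw [hR]
    rcases h with h | h
    · linarith
    · have h1 := hC.B_le'
      have h2 := mul_nonneg hC.lam_nonneg
        (by linarith [neg_betaG_le_cumDiff hP p e i t] : 0 ≤ P.cumDiff p e i t + P.betaG)
      push_cast at h
      have : (v + t + 1 - (t + 1) : ℝ) = v := by ring
      rw [this] at h
      linarith

lemma excess_succ_of_off (hoff : P.chaseState p e v i (t + 1) = 0) :
    P.excess p e i (P.chaseState p e v i) (t + 1) = P.excess p e i (P.chaseState p e v i) t := by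
  rw [excess_succ, hoff, max_eq_left (by simp)]; simp

lemma excess_succ_of_on (hon : P.chaseState p e v i t = 1)
    (hon' : P.chaseState p e v i (t + 1) = 1) :
    P.excess p e i (P.chaseState p e v i) (t + 1)
      = P.excess p e i (P.chaseState p e v i) t - P.costDiff p e i (t + 1) := by
  rw [excess_succ, hon, hon']; simp

lemma excess_succ_of_start (hoff : P.chaseState p e v i t = 0)
    (hon' : P.chaseState p e v i (t + 1) = 1) :
    P.excess p e i (P.chaseState p e v i) (t + 1)
      = P.excess p e i (P.chaseState p e v i) t + P.betaG - P.costDiff p e i (t + 1) := by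
  rw [excess_succ, hoff, hon']; simp

/-- The step of the invariant; a deficit `dfc` is written off at each start. -/
lemma chaseInvariant_step (hP : P.Valid) (hC : P.ChaseConstants v κ lam B dfc)
    (hr : P.costDiff p e i (t + 1) ≤ P.maxDiff) (hw0 : 0 ≤ w)
    (hw : P.cumDiff p e i (t + 1) ≠ -P.betaG → P.costDiff p e i (t + 1) + P.cm ≤ w)
    (h : P.ChaseInvariant p e v i κ lam B dfc (W + dfc * upSwitches (P.chaseState p e v i) t)
      (P.excess p e i (P.chaseState p e v i) t) t) :
    P.ChaseInvariant p e v i κ lam B dfc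
      (W + w + dfc * upSwitches (P.chaseState p e v i) (t + 1))
      (P.excess p e i (P.chaseState p e v i) (t + 1)) (t + 1) := by
  have hβ := hP.betaG_pos
  have hD := maxDiff_pos hP
  have hκ : 0 ≤ κ / 2 := hC.lam_nonneg.trans hC.lam_le
  have hRβ := neg_betaG_le_cumDiff hP p e i t
  have hR0 := cumDiff_nonpos hP p e i t
  have hfrac : 0 ≤ P.cm / P.maxDiff := div_nonneg hP.cm_nonneg hD.le
  rcases h with ⟨hy, hR, h⟩ | ⟨hy, hR, s, hs, hs0, hsv, h⟩ | ⟨hy, hR, h⟩ |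
    ⟨hy, hR, hR', s, hs, hs0, hsv, h⟩
  · -- the generator is off and the last hit was `-betaG`
    have stay : P.chaseState p e v i (t + 1) = 0 → P.cumDiff p e i (t + 1) ≠ 0 →
        P.ChaseInvariant p e v i κ lam B dfc
          (W + w + dfc * upSwitches (P.chaseState p e v i) (t + 1))
          (P.excess p e i (P.chaseState p e v i) (t + 1)) (t + 1) := by
      intro hy' hR1
      left
      refine ⟨hy', hR1, ?_⟩
      rw [excess_succ_of_off hy', upSwitches_succ_of_le (by omega)]
      by_cases hR2 : P.cumDiff p e i (t + 1) = -P.betaG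
      · rw [hR2]
        have : 0 ≤ (1 + P.cm / P.maxDiff) * (P.cumDiff p e i t + P.betaG) :=
          mul_nonneg (by linarith) (by linarith)
        linarith
      · rw [cumDiff_succ_eq hR1 hR2]
        have h1 := hw hR2
        have h2 : P.cm / P.maxDiff * P.costDiff p e i (t + 1) ≤ P.cm :=
          (mul_le_mul_of_nonneg_left hr hfrac).trans (div_mul_cancel₀ _ hD.ne').le
        linarith
    by_cases hex : ∃ s, P.NextHit p e i t s ∧ s ≤ t + 1 + v
    · obtain ⟨s, hs, hsv⟩ := hex
      by_cases hs0 : P.cumDiff p e i s = 0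
      · have hacc : P.RiseAccount p e v i κ
            (W + dfc * upSwitches (P.chaseState p e v i) (t + 1) - dfc)
            (P.excess p e i (P.chaseState p e v i) t + P.betaG) t s := by
          refine ⟨-P.cumDiff p e i t, 0, by linarith, by linarith, ?_, by simp, ?_⟩
          · by_cases hR2 : P.cumDiff p e i t = -P.betaG
            · right; linarith
            · left
              have := window_lt_of_off hR hy hs hs0 hR2
              omega
          · rw [upSwitches_succ_of_on hy (chaseState_succ_of_zero hs hsv hs0)]
            push_cast
            linarith
        have := chaseInvariant_rise hP hC hr hs hs0 hsv hacc
          (w := w) (by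
            by_cases hR2 : P.cumDiff p e i (t + 1) = -P.betaG
            · exfalso
              rcases (by have := hs.1; omega : t + 1 ≤ s).lt_or_eq with hlt | rfl
              · exact (hs.2.2 (t + 1) (by omega) hlt).2 hR2
              · linarith
            · exact hw hR2)
        rw [excess_succ_of_start hy this.1]
        convert this.2 using 1
        ring
      · refine stay (chaseState_succ_of_neg hs hsv hs0) fun h1 => hs0 ?_
        rwa [hs.unique (nextHit_self (Or.inl h1))]
    · push Not at hex
      refine stay ((chaseState_succ_of_none fun s hs => hex s hs).trans hy) fun h1 => ?_
      have := hex _ (nextHit_self (Or.inl h1))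
      omega
  · have := chaseInvariant_rise hP hC hr hs hs0 (by omega) h
      (w := w) (by
        by_cases hR2 : P.cumDiff p e i (t + 1) = -P.betaG
        · exfalso
          rcases (by have := hs.1; omega : t + 1 ≤ s).lt_or_eq with hlt | rfl
          · exact (hs.2.2 (t + 1) (by omega) hlt).2 hR2
          · linarith
        · exact hw hR2)
    rw [excess_succ_of_on hy this.1, upSwitches_succ_of_le (by omega)]
    convert this.2 using 1
    ring
  · -- the generator is on and the last hit was `0`
    have stay : P.chaseState p e v i (t + 1) = 1 → P.cumDiff p e i (t + 1) ≠ -P.betaG →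
        P.ChaseInvariant p e v i κ lam B dfc
          (W + w + dfc * upSwitches (P.chaseState p e v i) (t + 1))
          (P.excess p e i (P.chaseState p e v i) (t + 1)) (t + 1) := by
      intro hy' hR1
      right; right; left
      refine ⟨hy', hR1, ?_⟩
      rw [excess_succ_of_on hy hy', upSwitches_succ_of_le (by omega)]
      have h1 := mul_le_mul_of_nonneg_left (cumDiff_succ_le hP hR1) hκ
      linarith
    by_cases hex : ∃ s, P.NextHit p e i t s ∧ s ≤ t + 1 + v
    · obtain ⟨s, hs, hsv⟩ := hex
      by_cases hs0 : P.cumDiff p e i s = 0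
      · refine stay (chaseState_succ_of_zero hs hsv hs0) fun h1 => ?_
        rw [hs.unique (nextHit_self (Or.inr h1))] at hs0
        linarith
      · have hacc : P.FallAccount p e v i κ lam B
            (W + dfc * upSwitches (P.chaseState p e v i) t)
            (P.excess p e i (P.chaseState p e v i) t) t s := by
          by_cases hR2 : P.cumDiff p e i t = 0
          · left
            have := hC.B_le
            rw [hR2] at h
            linarith
          · right
            have := window_lt_of_on hR2 hy hs hs0 hR
            have hsv' : (s : ℝ) = t + 1 + v := by exact_mod_cast (by omega : s = t + 1 + v)
            rw [hsv']
            have := mul_le_mul_of_nonneg_right hC.lam_le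
              (by linarith : 0 ≤ P.cumDiff p e i t + P.betaG)
            have h0 : (v + t + 1 - (t + 1 + v) : ℝ) = 0 := by ring
            rw [h0]
            linarith
        have := chaseInvariant_fall hP hC hs hs0 hsv hacc hw0 hw
        rw [excess_succ_of_off this.1, upSwitches_succ_of_le (by omega)]
        convert this.2 using 1
        ring
    · push Not at hex
      refine stay ((chaseState_succ_of_none fun s hs => hex s hs).trans hy) fun h1 => ?_
      have := hex _ (nextHit_self (Or.inr h1))
      omega
  · have := chaseInvariant_fall hP hC hs hs0 (by omega) h hw0 hw
    rw [excess_succ_of_off this.1, upSwitches_succ_of_le (by omega)]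
    convert this.2 using 1
    ring

/-- Without demand, `R` decreases by `cm` in each slot until the next hit. -/
lemma cumDiff_add_of_no_demand {T : ℕ} (hafter : ∀ t, T < t → P.costDiff p e i t = -P.cm) (n : ℕ)
    (hn : ∀ u, T < u → u ≤ T + n → P.cumDiff p e i u ≠ 0 ∧ P.cumDiff p e i u ≠ -P.betaG) :
    P.cumDiff p e i (T + n) = P.cumDiff p e i T - n * P.cm := by
  induction n with
  | zero => simp
  | succ n ih =>
    have h1 := hn (T + n + 1) (by omega) (by omega)
    rw [← add_assoc, cumDiff_succ_eq h1.1 h1.2, ih fun u hu hu' => hn u hu (by omega),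
      hafter _ (by omega)]
    push_cast
    ring

/-- Without demand, `R` does not rise to `0`. -/
lemma cumDiff_ne_zero_of_no_demand (hP : P.Valid) {T : ℕ}
    (hafter : ∀ t, T < t → P.costDiff p e i t = -P.cm) (hR : P.cumDiff p e i T ≠ 0) (n : ℕ) :
    P.cumDiff p e i (T + n) ≠ 0 := by
  induction n with
  | zero => exact hR
  | succ n ih =>
    rw [← add_assoc]
    intro h0
    have h1 := le_of_cumDiff_succ_eq_zero hP h0
    have h2 := (cumDiff_nonpos hP p e i (T + n)).lt_of_ne ih
    rw [hafter _ (by omega)] at h1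
    linarith [hP.cm_nonneg]

/-- The excess cost of CHASE over grid power is at most `2 / κ` times the credit `w`, up to a deficit
`dfc` per start. If there is a look-ahead, there must be no demand after the horizon: otherwise a
generator could be started for a demand that is never charged. -/
lemma excess_chase_le (hP : P.Valid) (hC : P.ChaseConstants v κ lam B dfc) {T : ℕ} {w : ℕ → ℝ}
    (hr : ∀ t, 1 ≤ t → P.costDiff p e i t ≤ P.maxDiff) (hw0 : ∀ t, 0 ≤ w t)
    (hw : ∀ t, P.cumDiff p e i t ≠ -P.betaG → P.costDiff p e i t + P.cm ≤ w t)
    (hafter : 1 ≤ v → ∀ t, T < t → P.costDiff p e i t = -P.cm) :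
    κ / 2 * P.excess p e i (P.chaseState p e v i) T
      ≤ ∑ t ∈ Finset.Icc 1 T, w t + dfc * upSwitches (P.chaseState p e v i) T := by
  have hβ := hP.betaG_pos
  have hD := maxDiff_pos hP
  have hκ : 0 ≤ κ / 2 := hC.lam_nonneg.trans hC.lam_le
  have hRβ := neg_betaG_le_cumDiff hP p e i T
  have hfrac : 0 ≤ P.cm / P.maxDiff := div_nonneg hP.cm_nonneg hD.le
  have inv : ∀ t, P.ChaseInvariant p e v i κ lam B dfc
      (∑ t ∈ Finset.Icc 1 t, w t + dfc * upSwitches (P.chaseState p e v i) t)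
      (P.excess p e i (P.chaseState p e v i) t) t := by
    intro t
    induction t with
    | zero =>
      left
      refine ⟨rfl, by simp [cumDiff, hβ.ne'], by simp [cumDiff, excess]⟩
    | succ t ih =>
      rw [Finset.sum_Icc_succ_top (by omega)]
      exact chaseInvariant_step hP hC (hr _ (by omega)) (hw0 _) (hw _) ih
  rcases inv T with ⟨hy, hR, h⟩ | ⟨hy, hR, s, hs, hs0, hsv, h⟩ | ⟨hy, hR, h⟩ |
    ⟨hy, hR, hR', s, hs, hs0, hsv, h⟩
  · have : 0 ≤ (1 + P.cm / P.maxDiff) * (P.cumDiff p e i T + P.betaG) :=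
      mul_nonneg (by linarith) (by linarith)
    linarith
  · exfalso
    have hTs := hs.1
    refine cumDiff_ne_zero_of_no_demand hP (hafter (by omega)) hR (s - T) ?_
    rwa [Nat.add_sub_cancel' hTs.le]
  · by_cases hR0 : P.cumDiff p e i T = 0
    · rw [hR0] at h
      have := hC.B_le
      linarith
    have hge : v * P.cm ≤ P.cumDiff p e i T + P.betaG := by
      rcases Nat.eq_zero_or_pos v with rfl | hv
      · simp; linarith
      have hno : ∀ u, T < u → u ≤ T + v →
          P.cumDiff p e i u ≠ 0 ∧ P.cumDiff p e i u ≠ -P.betaG := by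
        intro u hu huv
        by_contra hcon
        obtain ⟨r, hru, hr⟩ := exists_nextHit (P := P) (p := p) (e := e) (i := i) hu (by tauto)
        have hTr := hr.1
        have h1 : P.cumDiff p e i r ≠ 0 := by
          have := cumDiff_ne_zero_of_no_demand hP (hafter hv) hR0 (r - T)
          rwa [Nat.add_sub_cancel' hTr.le] at this
        have := window_lt_of_on hR0 hy hr h1 hR
        omega
      have h1 := cumDiff_add_of_no_demand (hafter hv) v hno
      have h2 := neg_betaG_le_cumDiff hP p e i (T + v)
      linarith
    have h1 := mul_le_mul_of_nonneg_left hge hC.lam_nonneg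
    have h2 := mul_le_mul_of_nonneg_right hC.lam_le
      (by linarith : 0 ≤ P.cumDiff p e i T + P.betaG)
    have h3 := hC.B_le'
    linarith
  · rcases h with h | h
    · exact h
    have hTs := hs.1
    have h1 := cumDiff_add_of_no_demand (hafter (by omega)) (s - 1 - T)
      (fun u hu hu' => hs.2.2 u hu (by omega))
    have h2 := neg_betaG_le_cumDiff hP p e i (T + (s - 1 - T))
    have h3 : ((s - 1 - T : ℕ) : ℝ) = s - 1 - T := by
      rw [Nat.sub_sub, Nat.cast_sub (by omega)]; push_cast; ring
    rw [h1, h3] at h2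
    have h4 := mul_le_mul_of_nonneg_left (by linarith :
      (s - 1 - T : ℝ) * P.cm ≤ P.cumDiff p e i T + P.betaG) hC.lam_nonneg
    have h5 := hC.B_le'
    linarith

end

/-! ### The constants of CHASE -/

/-- The ratio constant of CHASE for a look-ahead window of real length `v`. -/
noncomputable def chaseConst (P : DCParams) (v : ℝ) : ℝ :=
  1 + P.cm / P.maxDiff + P.cm * v / P.betaG

lemma chaseConstants {P : DCParams} (hP : P.Valid) {n : ℕ} {v dfc : ℝ} (hv0 : 0 ≤ v)
    (hv : v ≤ n + 1) (hd : 0 ≤ dfc) (h : 1 ≤ n ∨ P.cm * v / 2 ≤ dfc) :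
    P.ChaseConstants n (P.chaseConst v) (min 1 (P.chaseConst v / 2))
      (min (min 1 (P.chaseConst v / 2) * (n * P.cm)) (P.chaseConst v / 2 * P.betaG)) dfc := by
  have hβ := hP.betaG_pos
  have hD := maxDiff_pos hP
  have hcm := hP.cm_nonneg
  set κ := P.chaseConst v with hκ
  have hx : 0 ≤ P.cm / P.maxDiff := div_nonneg hcm hD.le
  have hz : 0 ≤ P.cm * v / P.betaG := div_nonneg (mul_nonneg hcm hv0) hβ.le
  have hκ1 : 1 + P.cm / P.maxDiff ≤ κ := by rw [hκ, chaseConst]; linarith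
  have hκβ : κ * P.betaG = (1 + P.cm / P.maxDiff) * P.betaG + P.cm * v := by
    rw [hκ, chaseConst, add_mul _ (P.cm * v / P.betaG), div_mul_cancel₀ _ hβ.ne']
  have hn : (0 : ℝ) ≤ n := Nat.cast_nonneg n
  have hcv : P.cm * v ≤ (n + 1) * P.cm := by nlinarith
  have hcn : 0 ≤ n * P.cm := mul_nonneg hn hcm
  have hcv0 : 0 ≤ P.cm * v := mul_nonneg hcm hv0
  have hdn : P.cm * v ≤ 2 * dfc + 2 * (n * P.cm) := by
    rcases h with h | h
    · have : (1 : ℝ) ≤ n := by exact_mod_cast h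
      nlinarith
    · linarith
  refine ⟨hd, le_min zero_le_one (by linarith), min_le_left _ _, min_le_right _ _,
    min_le_right _ _, min_le_left _ _, ?_, ?_⟩
  · intro Y S hY0 hY hYS hS
    have hS0 : 0 ≤ S := hY0.trans hYS
    have hxS : P.cm / P.maxDiff * S ≤ (n + 1) * P.cm := by
      have := mul_le_mul_of_nonneg_left hS hx
      rwa [mul_left_comm, div_mul_cancel₀ _ hD.ne'] at this
    have hxY := mul_le_mul_of_nonneg_left hYS hx
    have hκS : (1 + P.cm / P.maxDiff) * S ≤ κ * S := mul_le_mul_of_nonneg_right hκ1 hS0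
    rw [hκβ]
    rcases min_choice (min 1 (κ / 2) * (n * P.cm)) (κ / 2 * P.betaG) with hB | hB
    · rw [hB]
      rcases le_total 1 (κ / 2) with h1 | h1
      · rw [min_eq_left h1]
        nlinarith
      · rw [min_eq_right h1]
        have h2 : P.cm / P.maxDiff ≤ 1 := by linarith
        have h3 : P.cm / P.maxDiff * S ≤ 1 * S := mul_le_mul_of_nonneg_right h2 hS0
        have h4 : 0 ≤ κ / 2 * (n * P.cm) := mul_nonneg (by linarith) hcn
        nlinarith
    · rw [hB]
      nlinarith [mul_nonneg hx hβ.le]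
  · intro S j hj hS hSj
    have hxβ : P.cm / P.maxDiff * P.betaG ≤ j * P.cm := by
      have := mul_le_mul_of_nonneg_left (hS.trans hSj) hx
      rwa [mul_left_comm, div_mul_cancel₀ _ hD.ne'] at this
    have hκS : κ * P.betaG ≤ κ * S := mul_le_mul_of_nonneg_left hS (by linarith)
    have hjc : P.cm ≤ j * P.cm := by nlinarith
    rcases min_choice (min 1 (κ / 2) * (n * P.cm)) (κ / 2 * P.betaG) with hB | hB
    · rw [hB]
      have h1 : (1 : ℝ) / 2 ≤ min 1 (κ / 2) := le_min (by norm_num) (by linarith)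
      have h2 := mul_le_mul_of_nonneg_right h1 hcn
      nlinarith
    · rw [hB]
      nlinarith

end DCParams

/-! ### All servers under GCSR -/

namespace DCInput

lemma d_eq_sum (I : DCInput) (t n : ℕ) :
    I.d t n = I.d t 0 + ∑ i ∈ Finset.range n, I.subPower i t := by
  unfold subPower
  rw [Finset.sum_range_sub (fun i => I.d t i)]
  ring

section

variable {I : DCInput} {P : DCParams} {t : ℕ}

lemma Valid.d_nonneg (hI : I.Valid P) (ht : 1 ≤ t) (n : ℕ) : 0 ≤ I.d t n :=
  hI.power_nonneg t ht _ _ (Nat.cast_nonneg n) (hI.workload_nonneg t ht)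

lemma Valid.price_nonneg (hI : I.Valid P) (hP : P.Valid) (ht : 1 ≤ t) : 0 ≤ I.p t :=
  hP.Pmin_nonneg.trans (hI.price_ge t ht)

/-- By convexity, the additional power of a server increases with its index. -/
lemma Valid.subPower_mono (hI : I.Valid P) (ht : 1 ≤ t) : Monotone fun i => I.subPower i t := by
  refine monotone_nat_of_le_succ fun i => ?_
  have hc := hI.power_convex_left t ht (I.a t) (hI.workload_nonneg t ht)
  have h := hc.2 (Set.mem_Ici.2 (Nat.cast_nonneg i)) (Set.mem_Ici.2 (Nat.cast_nonneg (i + 2)))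
    (by norm_num : (0 : ℝ) ≤ 1 / 2) (by norm_num : (0 : ℝ) ≤ 1 / 2) (by norm_num)
  have hmid : (1 / 2 : ℝ) • (i : ℝ) + (1 / 2 : ℝ) • ((i + 2 : ℕ) : ℝ) = ((i + 1 : ℕ) : ℝ) := by
    simp only [smul_eq_mul]; push_cast; ring
  rw [hmid] at h
  simp only [smul_eq_mul] at h
  unfold subPower d
  linarith

lemma Valid.dmin_le_subPower (hI : I.Valid P) (ht : 1 ≤ t) (i : ℕ) : P.dmin ≤ I.subPower i t :=
  (hI.dmin_le t ht).trans (hI.subPower_mono ht (Nat.zero_le i))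

lemma Valid.subPower_nonneg (hI : I.Valid P) (hP : P.Valid) (ht : 1 ≤ t) (i : ℕ) :
    0 ≤ I.subPower i t := hP.dmin_nonneg.trans (hI.dmin_le_subPower ht i)

lemma Valid.idleBound (hI : I.Valid P) (hP : P.Valid) (i : ℕ) :
    I.IdleBound i (P.dmin * P.Pmin) where
  nonneg := mul_nonneg hP.dmin_nonneg hP.Pmin_nonneg
  le t ht := by
    rw [mul_comm]
    exact mul_le_mul (hI.price_ge t ht) (hI.dmin_le_subPower ht i) hP.dmin_nonneg
      (hI.price_nonneg hP ht)

/-- Any set of active servers needs at most the sum of its additional powers: by convexity, the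
servers with the smallest indices need the least. -/
lemma Valid.d_sum_le (hI : I.Valid P) (ht : 1 ≤ t) (y : ℕ → ℕ)
    (hy : ∀ i, y i = 0 ∨ y i = 1) (n : ℕ) :
    I.d t (∑ i ∈ Finset.range n, y i)
      ≤ I.d t 0 + ∑ i ∈ Finset.range n, I.subPower i t * y i := by
  induction n with
  | zero => simp
  | succ n ih =>
    rw [Finset.sum_range_succ, Finset.sum_range_succ]
    rcases hy n with h | h
    · simpa [h] using ih
    · have hle : ∑ i ∈ Finset.range n, y i ≤ n := by
        calc ∑ i ∈ Finset.range n, y i ≤ ∑ _i ∈ Finset.range n, 1 :=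
              Finset.sum_le_sum fun i _ => by rcases hy i with h | h <;> omega
          _ = n := by simp
      have h1 : I.subPower (∑ i ∈ Finset.range n, y i) t ≤ I.subPower n t :=
        hI.subPower_mono ht hle
      rw [h]
      unfold subPower at h1 ih ⊢
      push_cast
      linarith

lemma Valid.le_d (hI : I.Valid P) (hP : P.Valid) (ht : 1 ≤ t) (x : ℕ → ℕ) (n : ℕ) :
    I.d t 0 + ∑ i ∈ Finset.range n, I.subPower i t * levelSeq x i t ≤ I.d t (x t) := by
  rw [d_eq_sum I t (x t)]
  have h1 : ∑ i ∈ Finset.range n, I.subPower i t * levelSeq x i t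
      = ∑ i ∈ (Finset.range n).filter (fun i => i < x t), I.subPower i t := by
    rw [Finset.sum_filter]
    refine Finset.sum_congr rfl fun i _ => ?_
    unfold levelSeq
    split_ifs <;> simp
  have h2 : ∑ i ∈ (Finset.range n).filter (fun i => i < x t), I.subPower i t
      ≤ ∑ i ∈ Finset.range (x t), I.subPower i t :=
    Finset.sum_le_sum_of_subset_of_nonneg
      (fun i hi => Finset.mem_range.2 (Finset.mem_filter.1 hi).2)
      fun i _ _ => hI.subPower_nonneg hP ht i
  linarith

lemma subWorkload_pos_iff {i : ℕ} : 0 < I.subWorkload i t ↔ (i : ℝ) < I.a t := by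
  unfold subWorkload
  simp

lemma Valid.not_workload_after (hI : I.Valid P) (ht : I.T < t) (i : ℕ) :
    ¬ 0 < I.subWorkload i t := by
  rw [subWorkload_pos_iff, hI.workload_after t ht]
  exact not_lt.2 (Nat.cast_nonneg i)

lemma Valid.lt_numServers (hI : I.Valid P) (ht : 1 ≤ t) {i : ℕ} (h : 0 < I.subWorkload i t) :
    i < I.numServers := by
  have hT : t ≤ I.T := by
    by_contra hT
    exact hI.not_workload_after (not_le.1 hT) i h
  rw [subWorkload_pos_iff] at h
  exact (Nat.lt_ceil.2 h).trans_le
    (Finset.le_sup (f := fun t => ⌈I.a t⌉₊) (Finset.mem_Icc.2 ⟨ht, hT⟩))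

lemma workload_le_gcsr (ht : 1 ≤ t) (hT : t ≤ I.T) (w : ℕ) : I.a t ≤ I.gcsr P w t := by
  have hM : ⌈I.a t⌉₊ ≤ I.numServers :=
    Finset.le_sup (f := fun t => ⌈I.a t⌉₊) (Finset.mem_Icc.2 ⟨ht, hT⟩)
  have h : ⌈I.a t⌉₊ ≤ I.gcsr P w t := by
    calc ⌈I.a t⌉₊ = ∑ i ∈ Finset.range ⌈I.a t⌉₊, 1 := by simp
      _ = ∑ i ∈ Finset.range ⌈I.a t⌉₊, (I.gcsrState P w i t).1 := by
        refine Finset.sum_congr rfl fun i hi => ?_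
        obtain ⟨u, rfl⟩ : ∃ u, t = u + 1 := ⟨t - 1, by omega⟩
        rw [gcsrState_succ_busy (subWorkload_pos_iff.2 (Nat.lt_ceil.1 (Finset.mem_range.1 hi)))]
      _ ≤ I.gcsr P w t :=
        Finset.sum_le_sum_of_subset (Finset.range_mono hM)
  exact (Nat.le_ceil _).trans (by exact_mod_cast h)

lemma levelSeq_of_workload {x : ℕ → ℕ} (hx : I.a t ≤ x t) {i : ℕ} (h : 0 < I.subWorkload i t) :
    levelSeq x i t = 1 := by
  rw [subWorkload_pos_iff] at h
  have : i < x t := by exact_mod_cast h.trans_le hx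
  simp [levelSeq, this]

end

/-- The cost of the server schedule `x` when all power comes from the grid. -/
noncomputable def gridCost (I : DCInput) (P : DCParams) (x : ℕ → ℕ) : ℝ :=
  ∑ t ∈ Finset.Icc 1 I.T, I.p t * I.d t (x t) + P.betaS * upSwitches x I.T

/-- The grid cost of the power that a data center without active servers needs. -/
def baseCost (I : DCInput) : ℝ := ∑ t ∈ Finset.Icc 1 I.T, I.p t * I.d t 0

section

variable {I : DCInput} {P : DCParams}

lemma gridCost_sum_le (hI : I.Valid P) (hP : P.Valid) (n : ℕ) (y : ℕ → ℕ → ℕ)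
    (hy : ∀ i t, y i t = 0 ∨ y i t = 1) :
    I.gridCost P (fun t => ∑ i ∈ Finset.range n, y i t)
      ≤ I.baseCost + ∑ i ∈ Finset.range n, I.serverCost P i (y i) I.T := by
  unfold gridCost baseCost serverCost
  rw [Finset.sum_add_distrib, ← Finset.mul_sum, Finset.sum_comm, ← add_assoc,
    ← Finset.sum_add_distrib]
  refine add_le_add (Finset.sum_le_sum fun t ht => ?_)
    (mul_le_mul_of_nonneg_left (upSwitches_sum_le n y I.T) hP.betaS_pos.le)
  have ht1 := (Finset.mem_Icc.1 ht).1
  refine (mul_le_mul_of_nonneg_left (hI.d_sum_le ht1 (fun i => y i t) (fun i => hy i t) n)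
    (hI.price_nonneg hP ht1)).trans_eq ?_
  rw [mul_add, Finset.mul_sum]
  congr 1
  exact Finset.sum_congr rfl fun i _ => by unfold idleCost; ring

lemma le_gridCost (hI : I.Valid P) (hP : P.Valid) (n : ℕ) (x : ℕ → ℕ) :
    I.baseCost + ∑ i ∈ Finset.range n, I.serverCost P i (levelSeq x i) I.T ≤ I.gridCost P x := by
  unfold gridCost baseCost serverCost
  rw [Finset.sum_add_distrib, ← Finset.mul_sum, Finset.sum_comm, ← add_assoc,
    ← Finset.sum_add_distrib]
  refine add_le_add (Finset.sum_le_sum fun t ht => ?_)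
    (mul_le_mul_of_nonneg_left (sum_upSwitches_levelSeq_le n x I.T) hP.betaS_pos.le)
  have ht1 := (Finset.mem_Icc.1 ht).1
  refine le_trans (Eq.le ?_) (mul_le_mul_of_nonneg_left (hI.le_d hP ht1 x n)
    (hI.price_nonneg hP ht1))
  rw [mul_add, Finset.mul_sum]
  congr 1
  exact Finset.sum_congr rfl fun i _ => by unfold idleCost; ring

lemma baseCost_nonneg (hI : I.Valid P) (hP : P.Valid) : 0 ≤ I.baseCost :=
  Finset.sum_nonneg fun _ ht => mul_nonneg (hI.price_nonneg hP (Finset.mem_Icc.1 ht).1)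
    (hI.d_nonneg (Finset.mem_Icc.1 ht).1 0)

lemma two_sub_alphaS_mul (hP : P.Valid) (w : ℕ) :
    (2 - P.alphaS w) * P.betaS = P.betaS + max 0 (P.betaS - w * (P.dmin * P.Pmin)) := by
  have hβ := hP.betaS_pos
  unfold DCParams.alphaS
  rcases le_total P.betaS (w * (P.dmin * P.Pmin)) with h | h
  · rw [min_eq_left ((one_le_div hβ).2 h), max_eq_left (by linarith)]; ring
  · rw [min_eq_right ((div_le_one hβ).2 h), max_eq_right (by linarith), sub_mul,
      div_mul_cancel₀ _ hβ.ne']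
    ring

/-- GCSR is `(2 - α_s)`-competitive when all power comes from the grid. -/
lemma gridCost_gcsr_le (hI : I.Valid P) (hP : P.Valid) (w : ℕ) {x : ℕ → ℕ} (hx0 : x 0 = 0)
    (hx : ∀ t, 1 ≤ t → t ≤ I.T → I.a t ≤ x t) :
    I.gridCost P (I.gcsr P w) ≤ (2 - P.alphaS w) * I.gridCost P x := by
  have hα : P.alphaS w ≤ 1 := min_le_left _ _
  have h1 := gridCost_sum_le hI hP I.numServers (fun i t => (I.gcsrState P w i t).1)
    fun i t => I.gcsrState_fst P w i t
  have h2 : ∀ i ∈ Finset.range I.numServers,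
      I.serverCost P i (fun t => (I.gcsrState P w i t).1) I.T
        ≤ (2 - P.alphaS w) * I.serverCost P i (levelSeq x i) I.T := fun i _ =>
    serverCost_gcsr_le hP (hI.idleBound hP i) rfl (two_sub_alphaS_mul hP w) (levelSeq_eq x i)
      (by simp [levelSeq, hx0])
      (fun t ht hT hb => levelSeq_of_workload (hx t ht hT) hb)
      (fun t ht => hI.not_workload_after ht i)
  have h3 := Finset.sum_le_sum h2
  rw [← Finset.mul_sum] at h3
  have h4 := mul_le_mul_of_nonneg_left (le_gridCost hI hP I.numServers x)
    (by linarith : 0 ≤ 2 - P.alphaS w)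
  have h5 := baseCost_nonneg hI hP
  have h6 : I.gridCost P (I.gcsr P w)
      = I.gridCost P fun t => ∑ i ∈ Finset.range I.numServers, (I.gcsrState P w i t).1 := rfl
  rw [h6]
  nlinarith

/-- When the window reaches the break-even point, all servers are off after the horizon. -/
lemma gcsr_after (hI : I.Valid P) (hP : P.Valid) {w t : ℕ}
    (hw : P.betaS ≤ w * (P.dmin * P.Pmin)) (ht : I.T < t) : I.gcsr P w t = 0 := by
  refine Finset.sum_eq_zero fun i _ => ?_
  obtain ⟨u, rfl⟩ : ∃ u, t = u + 1 := ⟨t - 1, by omega⟩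
  have hb := hI.idleBound hP i
  have hoff : I.GcsrOff P w i (u + 1) (I.gcsrState P w i u).2 := by
    obtain ⟨s, hs⟩ := exists_isLeast_of_mem (S := {s | s ∈ Set.Icc (u + 1) (u + 1 + w) ∧
      P.betaS ≤ (I.gcsrState P w i u).2
        + ∑ v ∈ Finset.Icc (u + 1) s, I.p v * I.subPower i v}) (s := u + 1 + w) (by
      refine ⟨⟨by omega, le_rfl⟩, ?_⟩
      have h1 := hb.mul_le_sum (t := u + 1) (by omega) w
      have h2 : ∑ v ∈ Finset.Ico (u + 1) (u + 1 + w), I.idleCost i v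
          ≤ ∑ v ∈ Finset.Icc (u + 1) (u + 1 + w), I.idleCost i v :=
        Finset.sum_le_sum_of_subset_of_nonneg Finset.Ico_subset_Icc_self fun v hv _ =>
          hb.cost_nonneg v (by have := (Finset.mem_Icc.1 hv).1; omega)
      have h3 := gcsrState_snd_nonneg (P := P) (w := w) hb.cost_nonneg u
      unfold idleCost at h1 h2
      linarith)
    exact ⟨s, hs, fun v hv => hI.not_workload_after (by have := hv.1; omega) i⟩
  rw [gcsrState_succ_off (hI.not_workload_after ht i) hoff]

end

end DCInput

/-! ### Starts of a generator without look-ahead, compared with an arbitrary schedule -/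

/-- Let `y` and `o` be sequences of on/off states. If `o` pays `c` whenever it switches on, whenever
it is off while `y` switches on, and whenever it is on while `y` switches off, then it pays `c` for
each start of `y`: between two starts, `o` either starts itself or misses one of the switches. -/
lemma mul_upSwitches_le_sum {y o : ℕ → ℕ} {x : ℕ → ℝ} {c : ℝ} {T : ℕ} (hc : 0 ≤ c)
    (hy : ∀ t, y t = 0 ∨ y t = 1) (ho : ∀ t, o t = 0 ∨ o t = 1) (ho0 : o 0 = 0)
    (hx : ∀ t < T, 0 ≤ x (t + 1))
    (h1 : ∀ t < T, o t = 0 → o (t + 1) = 1 → c ≤ x (t + 1))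
    (h2 : ∀ t < T, y t = 0 → y (t + 1) = 1 → o (t + 1) = 0 → c ≤ x (t + 1))
    (h3 : ∀ t < T, y t = 1 → y (t + 1) = 0 → o (t + 1) = 1 → c ≤ x (t + 1)) :
    c * upSwitches y T ≤ ∑ t ∈ Finset.Icc 1 T, x t := by
  have key : ∀ t ≤ T, c * upSwitches y t + (if y t = 0 ∧ o t = 1 then c else 0)
      ≤ ∑ u ∈ Finset.Icc 1 t, x u := by
    intro t
    induction t with
    | zero => simp [ho0]
    | succ t ih =>
      intro ht
      have ih := ih (by omega)
      have hx := hx t (by omega)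
      have h1 := h1 t (by omega)
      have h2 := h2 t (by omega)
      have h3 := h3 t (by omega)
      rw [Finset.sum_Icc_succ_top (by omega)]
      rcases hy t with a | a <;> rcases hy (t + 1) with a' | a'
      · rw [upSwitches_succ_of_le (by omega)]
        rcases ho t with b | b <;> rcases ho (t + 1) with b' | b' <;>
          simp [a, a', b, b'] at ih h1 h2 h3 ⊢ <;> linarith
      · rw [upSwitches_succ_of_on a a']
        rcases ho t with b | b <;> rcases ho (t + 1) with b' | b' <;>
          simp [a, a', b, b'] at ih h1 h2 h3 ⊢ <;> linarith
      · rw [upSwitches_succ_of_le (by omega)]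
        rcases ho t with b | b <;> rcases ho (t + 1) with b' | b' <;>
          simp [a, a', b, b'] at ih h1 h2 h3 ⊢ <;> linarith
      · rw [upSwitches_succ_of_le (by omega)]
        rcases ho t with b | b <;> rcases ho (t + 1) with b' | b' <;>
          simp [a, a', b, b'] at ih h1 h2 h3 ⊢ <;> linarith
  have := key T le_rfl
  split_ifs at this <;> linarith

namespace DCParams

section

variable {P : DCParams} {p e : ℕ → ℝ} {i t : ℕ}

/-- Without look-ahead, a generator keeps its state between hits. -/
lemma chaseState_succ_of_not_hit (h : P.cumDiff p e i (t + 1) ≠ 0)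
    (h' : P.cumDiff p e i (t + 1) ≠ -P.betaG) :
    P.chaseState p e 0 i (t + 1) = P.chaseState p e 0 i t := by
  refine chaseState_succ_of_none fun s hs => ?_
  by_contra hle
  have h1 := hs.1
  obtain rfl : s = t + 1 := by omega
  rcases hs.2.1 with h2 | h2
  · exact h h2
  · exact h' h2

/-- Without look-ahead, a generator starts only when `R` rises to `0`. -/
lemma costDiff_nonneg_of_start (hP : P.Valid) (h : P.chaseState p e 0 i t = 0)
    (h' : P.chaseState p e 0 i (t + 1) = 1) : 0 ≤ P.costDiff p e i (t + 1) := by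
  have hR : P.cumDiff p e i (t + 1) = 0 := by
    by_contra hR
    by_cases hR' : P.cumDiff p e i (t + 1) = -P.betaG
    · have := chaseState_succ_of_neg (v := 0) (nextHit_self (Or.inr hR')) (by omega) hR
      omega
    · have := chaseState_succ_of_not_hit hR hR'
      omega
  have := le_of_cumDiff_succ_eq_zero hP hR
  linarith [cumDiff_nonpos hP p e i t]

/-- Without look-ahead, a generator stops only when `R` hits `-betaG`. -/
lemma cumDiff_of_stop (h : P.chaseState p e 0 i t = 1)
    (h' : P.chaseState p e 0 i (t + 1) = 0) : P.cumDiff p e i (t + 1) = -P.betaG := by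
  by_contra hR'
  by_cases hR : P.cumDiff p e i (t + 1) = 0
  · have := chaseState_succ_of_zero (v := 0) (nextHit_self (Or.inl hR)) (by omega) hR
    omega
  · have := chaseState_succ_of_not_hit hR hR'
    omega

lemma one_le_chaseConst (hP : P.Valid) {v : ℝ} (hv : 0 ≤ v) : 1 ≤ P.chaseConst v := by
  have h1 := div_nonneg hP.cm_nonneg (maxDiff_pos hP).le
  have h2 := div_nonneg (mul_nonneg hP.cm_nonneg hv) hP.betaG_pos.le
  unfold chaseConst
  linarith

lemma cm_mul_le_chaseConst_mul (hP : P.Valid) (v : ℝ) :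
    P.cm * v ≤ P.chaseConst v * P.betaG := by
  have h1 := div_nonneg hP.cm_nonneg (maxDiff_pos hP).le
  have hβ := hP.betaG_pos
  unfold chaseConst
  rw [add_mul _ (P.cm * v / P.betaG), div_mul_cancel₀ _ hβ.ne']
  nlinarith

/-- The gain of a schedule that uses the grid, relative to the claimed ratio, balances the loss of
CHASE per unit of grid cost. -/
lemma div_le_chaseConst_mul (hP : P.Valid) {v : ℝ} (hv : 0 ≤ v) :
    (P.Pmax - P.co) / P.Pmax ≤ P.chaseConst v * (P.gridFactor - 1) := by
  have hD := maxDiff_pos hP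
  have hF := one_le_gridFactor hP
  have hL := hP.L_pos
  have hPm := Pmax_pos hP
  have hm := co_lt_Pmax hP
  have hF2 := gridFactor_mul hP
  have h2 := div_nonneg (mul_nonneg hP.cm_nonneg hv) hP.betaG_pos.le
  have h3 : 1 + P.cm / P.maxDiff ≤ P.chaseConst v := by unfold chaseConst; linarith
  have h4 : (1 + P.cm / P.maxDiff) * P.maxDiff = P.L * (P.Pmax - P.co) := by
    rw [add_mul, div_mul_cancel₀ _ hD.ne']; unfold maxDiff; ring
  have hq : 0 < P.co * P.L + P.cm := by
    have h := mul_pos hP.onsite_pos hL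
    rwa [add_mul, div_mul_cancel₀ _ hL.ne'] at h
  have h5 : (P.gridFactor - 1) * (P.co * P.L + P.cm) = P.maxDiff := by
    rw [sub_mul, hF2]; unfold maxDiff; ring
  have h6 : (1 + P.cm / P.maxDiff) * (P.gridFactor - 1) * (P.co * P.L + P.cm)
      = P.L * (P.Pmax - P.co) := by rw [mul_assoc, h5, h4]
  have h7 : (P.Pmax - P.co) / P.Pmax * (P.co * P.L + P.cm) ≤ P.L * (P.Pmax - P.co) := by
    rw [div_mul_eq_mul_div, div_le_iff₀ hPm]
    unfold maxDiff at hD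
    nlinarith
  refine le_trans (le_of_mul_le_mul_right (h7.trans h6.ge) hq)
    (mul_le_mul_of_nonneg_right h3 (by linarith))

/-- The slack of generator `i` in a slot, for an arbitrary state `o`, demand `e` and price `p`, see
`slack_le`. -/
noncomputable def slotSlack (P : DCParams) (p e : ℝ) (o : ℕ) : ℝ :=
  (P.gridFactor - 1) * (p * e) + P.gridFactor * (o * (P.cm - max 0 (p - P.co) * e))

lemma slotSlack_nonneg (hP : P.Valid) {p e : ℝ} (hp0 : 0 ≤ p) (hp : p ≤ P.Pmax)
    (he : 0 ≤ e) (heL : e ≤ P.L) {o : ℕ} (ho : o = 0 ∨ o = 1) : 0 ≤ P.slotSlack p e o := by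
  unfold slotSlack
  rcases ho with rfl | rfl
  · have := mul_nonneg (sub_nonneg.2 (one_le_gridFactor hP)) (mul_nonneg hp0 he)
    simpa using this
  · have := grid_le_onsite hP hp0 hp he heL
    push_cast
    linarith

/-- The credit of generator `i` under CHASE: the largest saving of a slot on its demand, without the
slots where `R` is `-betaG`. -/
noncomputable def chaseCredit (P : DCParams) (p e : ℕ → ℝ) (i t : ℕ) : ℝ :=
  if P.cumDiff p e i t = -P.betaG then 0 else max 0 (p t - P.co) * P.subDemand e i t

lemma chaseCredit_le (hP : P.Valid) (p e : ℕ → ℝ) (i t : ℕ) :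
    P.chaseCredit p e i t ≤ max 0 (p t - P.co) * P.subDemand e i t := by
  unfold chaseCredit
  split_ifs
  · exact mul_nonneg (le_max_left _ _) (subDemand_nonneg hP e i t)
  · exact le_rfl

lemma chaseCredit_nonneg (hP : P.Valid) (p e : ℕ → ℝ) (i t : ℕ) : 0 ≤ P.chaseCredit p e i t := by
  unfold chaseCredit
  split_ifs
  · exact le_rfl
  · exact mul_nonneg (le_max_left _ _) (subDemand_nonneg hP e i t)

/-- `excess_chase_le` for the credit `chaseCredit` and the constant `chaseConst v`, where `v` is at
most the number `n + 1` of slots in the window of CHASE. -/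
lemma excess_chase_le_credit (hP : P.Valid) {n T : ℕ} {v dfc : ℝ} (hv0 : 0 ≤ v)
    (hv : v ≤ n + 1) (hd : 0 ≤ dfc) (h : 1 ≤ n ∨ P.cm * v / 2 ≤ dfc)
    (hp : ∀ t, 1 ≤ t → p t ≤ P.Pmax) (hafter : 1 ≤ n → ∀ t, T < t → e t = 0) :
    P.chaseConst v / 2 * P.excess p e i (P.chaseState p e n i) T
      ≤ ∑ t ∈ Finset.Icc 1 T, P.chaseCredit p e i t
        + dfc * upSwitches (P.chaseState p e n i) T := by
  refine excess_chase_le hP (chaseConstants hP hv0 hv hd h)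
    (fun t ht => costDiff_le hP (hp t ht) e i) (chaseCredit_nonneg hP p e i)
    (fun t ht => ?_) fun hn t ht => ?_
  · rw [chaseCredit, if_neg ht, costDiff_eq hP]; linarith
  · have : P.subDemand e i t = 0 := by
      unfold subDemand
      rw [hafter hn t ht, max_eq_left, min_eq_right hP.L_pos.le]
      have := mul_nonneg (Nat.cast_nonneg (α := ℝ) i) hP.L_pos.le
      linarith
    rw [costDiff_eq hP, this]; ring

/-- Without an integer look-ahead, the deficit per start that CHASE has against grid power, when it
is measured with the ratio for a window of length `v ≤ 1`, is made up for by the slack of any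
schedule `o` of the generator, for a demand `e'` that is at least `e`. -/
lemma credit_add_deficit_le (hP : P.Valid) {T : ℕ} {v : ℝ} (hv0 : 0 ≤ v) (hv1 : v ≤ 1)
    {e' : ℕ → ℝ} {o : ℕ → ℕ} (ho : ∀ t, o t = 0 ∨ o t = 1) (ho0 : o 0 = 0)
    (hp0 : ∀ t, 1 ≤ t → 0 ≤ p t) (hp : ∀ t, 1 ≤ t → p t ≤ P.Pmax)
    (he : ∀ t, 1 ≤ t → t ≤ T → e t ≤ e' t) :
    ∑ t ∈ Finset.Icc 1 T, P.chaseCredit p e i t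
        + P.cm * v / 2 * upSwitches (P.chaseState p e 0 i) T
      ≤ ∑ t ∈ Finset.Icc 1 T, ((P.Pmax - P.co) / P.Pmax * (p t * P.subDemand e' i t)
          + P.chaseConst v / 2 * P.slotSlack (p t) (P.subDemand e' i t) (o t))
        + P.chaseConst v / 2 * (P.gridFactor * P.betaG) * upSwitches o T := by
  have hκ := one_le_chaseConst hP hv0
  have hF := one_le_gridFactor hP
  have hcm := hP.cm_nonneg
  have hβ := hP.betaG_pos
  set κ := P.chaseConst v with hκdef
  have hcv : P.cm * v / 2 ≤ P.cm / 2 := by nlinarith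
  -- what `o` pays in a slot beyond the credit of CHASE
  set x : ℕ → ℝ := fun t => (P.Pmax - P.co) / P.Pmax * (p t * P.subDemand e' i t)
    + κ / 2 * P.slotSlack (p t) (P.subDemand e' i t) (o t) - P.chaseCredit p e i t
    + κ / 2 * (P.gridFactor * P.betaG) * max 0 ((o t : ℝ) - (o (t - 1) : ℝ)) with hx
  have hsum : ∑ t ∈ Finset.Icc 1 T, x t
      = ∑ t ∈ Finset.Icc 1 T, ((P.Pmax - P.co) / P.Pmax * (p t * P.subDemand e' i t)
          + κ / 2 * P.slotSlack (p t) (P.subDemand e' i t) (o t))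
        - ∑ t ∈ Finset.Icc 1 T, P.chaseCredit p e i t
        + κ / 2 * (P.gridFactor * P.betaG) * upSwitches o T := by
    rw [hx]
    simp only [Finset.sum_add_distrib, Finset.sum_sub_distrib, upSwitches, Finset.mul_sum]
  have hcoef : 0 ≤ κ / 2 * (P.gridFactor * P.betaG) :=
    mul_nonneg (by linarith) (mul_nonneg (by linarith) hβ.le)
  have hsw : ∀ t, 0 ≤ κ / 2 * (P.gridFactor * P.betaG) * max 0 ((o t : ℝ) - (o (t - 1) : ℝ)) :=
    fun t => mul_nonneg hcoef (le_max_left _ _)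
  have hslack : ∀ t < T, 0 ≤ P.slotSlack (p (t + 1)) (P.subDemand e' i (t + 1)) (o (t + 1)) :=
    fun t _ => slotSlack_nonneg hP (hp0 _ (by omega)) (hp _ (by omega))
      (subDemand_nonneg hP e' i _) (subDemand_le e' i _) (ho _)
  have hsav : ∀ t < T, max 0 (p (t + 1) - P.co) * P.subDemand e' i (t + 1)
      ≤ (P.Pmax - P.co) / P.Pmax * (p (t + 1) * P.subDemand e' i (t + 1)) := fun t _ =>
    saving_le hP (hp0 _ (by omega)) (hp _ (by omega)) (subDemand_nonneg hP e' i _)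
  have hmono : ∀ t < T, max 0 (p (t + 1) - P.co) * P.subDemand e i (t + 1)
      ≤ max 0 (p (t + 1) - P.co) * P.subDemand e' i (t + 1) := fun t ht =>
    mul_le_mul_of_nonneg_left (subDemand_mono (he _ (by omega) (by omega)) i) (le_max_left _ _)
  have hcredit : ∀ t < T, P.chaseCredit p e i (t + 1)
      ≤ (P.Pmax - P.co) / P.Pmax * (p (t + 1) * P.subDemand e' i (t + 1)) := fun t ht =>
    (chaseCredit_le hP p e i _).trans ((hmono t ht).trans (hsav t ht))
  have hmain := mul_upSwitches_le_sum (y := P.chaseState p e 0 i) (o := o) (x := x)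
    (c := P.cm * v / 2) (T := T) (by positivity) (P.chaseState_eq p e 0 i) ho ho0
    (fun t ht => by
      have h1 := hcredit t ht
      have h2 := hsw (t + 1)
      have h3 := mul_nonneg (by linarith : 0 ≤ κ / 2) (hslack t ht)
      simp only [hx]
      linarith)
    (fun t ht ho1 ho2 => by
      -- `o` starts and pays the startup cost
      have h1 := hcredit t ht
      have h3 := mul_nonneg (by linarith : 0 ≤ κ / 2) (hslack t ht)
      have h4 := cm_mul_le_chaseConst_mul hP v
      have h5 : κ * P.betaG ≤ κ * (P.gridFactor * P.betaG) := by
        refine mul_le_mul_of_nonneg_left ?_ (by linarith)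
        nlinarith
      have h6 : max 0 ((o (t + 1) : ℝ) - (o (t + 1 - 1) : ℝ)) = 1 := by
        simp [ho1, ho2]
      simp only [hx]
      rw [h6]
      linarith)
    (fun t ht hy1 hy2 ho1 => by
      -- `o` uses the grid although the cost difference is positive
      have h1 := hcredit t ht
      have h2 := hsw (t + 1)
      have h3 := costDiff_nonneg_of_start hP hy1 hy2
      rw [costDiff_eq hP] at h3
      have h4 := hmono t ht
      have h5 := hsav t ht
      have h6 := mul_le_mul_of_nonneg_right (div_le_chaseConst_mul hP hv0)
        (mul_nonneg (hp0 (t + 1) (by omega)) (subDemand_nonneg hP e' i (t + 1)))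
      simp only [hx, slotSlack, ho1]
      push_cast
      rw [← hκdef] at h6
      have h2' := hsw (t + 1)
      rw [ho1] at h2'
      push_cast at h2'
      linarith)
    (fun t ht hy1 hy2 ho1 => by
      -- `o` runs the generator although CHASE has just stopped it
      have hR := cumDiff_of_stop hy1 hy2
      have hcr : P.chaseCredit p e i (t + 1) = 0 := by rw [chaseCredit, if_pos hR]
      have h2 := hsw (t + 1)
      have h3 := hslack t ht
      have h4 : P.slotSlack (p (t + 1)) (P.subDemand e' i (t + 1)) (o (t + 1))
          ≤ κ * P.slotSlack (p (t + 1)) (P.subDemand e' i (t + 1)) (o (t + 1)) := by nlinarith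
      have hE := subDemand_nonneg hP e' i (t + 1)
      have hpp := hp0 (t + 1) (by omega)
      have h5 := hsav t ht
      have h6 : max 0 (p (t + 1) - P.co) * P.subDemand e' i (t + 1)
          ≤ p (t + 1) * P.subDemand e' i (t + 1) :=
        mul_le_mul_of_nonneg_right (max_le hpp (by linarith [hP.co_nonneg])) hE
      have h7 : P.cm ≤ (P.Pmax - P.co) / P.Pmax * (p (t + 1) * P.subDemand e' i (t + 1))
          + P.slotSlack (p (t + 1)) (P.subDemand e' i (t + 1)) (o (t + 1)) := by
        rw [slotSlack, ho1]
        push_cast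
        nlinarith
      have h8 : 0 ≤ (P.Pmax - P.co) / P.Pmax * (p (t + 1) * P.subDemand e' i (t + 1)) :=
        (mul_nonneg (le_max_left _ _) hE).trans h5
      simp only [hx]
      rw [hcr]
      linarith)
  rw [hsum] at hmain
  linarith

end

end DCParams

/-! ### The competitive ratio -/

namespace DCParams

lemma remainingWindow_nonneg (P : DCParams) (w : ℕ) : 0 ≤ P.remainingWindow w := by
  unfold remainingWindow
  split_ifs
  · exact le_rfl
  · exact le_max_left _ _

lemma floor_remainingWindow_le (P : DCParams) (hP : P.Valid) (w : ℕ) :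
    ⌊P.remainingWindow w⌋₊ ≤ w := by
  refine Nat.floor_le_of_le ?_
  unfold remainingWindow
  split_ifs
  · exact Nat.cast_nonneg w
  · exact max_le (Nat.cast_nonneg w) (sub_le_self _ (div_nonneg hP.betaS_pos.le
      (mul_nonneg hP.dmin_nonneg hP.Pmin_nonneg)))

lemma alphaS_nonneg {P : DCParams} (hP : P.Valid) (w : ℕ) : 0 ≤ P.alphaS w :=
  le_min zero_le_one (div_nonneg (mul_nonneg (Nat.cast_nonneg w)
    (mul_nonneg hP.dmin_nonneg hP.Pmin_nonneg)) hP.betaS_pos.le)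

lemma alphaS_le_one (P : DCParams) (w : ℕ) : P.alphaS w ≤ 1 := min_le_left _ _

lemma alphaG_nonneg {P : DCParams} (hP : P.Valid) (w : ℕ) : 0 ≤ P.alphaG w :=
  mul_nonneg (div_nonneg hP.cm_nonneg hP.betaG_pos.le) (P.remainingWindow_nonneg w)

/-- Part of the window is left to CHASE only if the window is longer than the break-even interval
of a server. -/
lemma betaS_le_of_remainingWindow_pos {P : DCParams} (hP : P.Valid) {w : ℕ}
    (h : 0 < P.remainingWindow w) :
    0 < P.dmin * P.Pmin ∧ P.remainingWindow w = w - P.betaS / (P.dmin * P.Pmin) ∧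
      P.betaS ≤ w * (P.dmin * P.Pmin) := by
  unfold remainingWindow at h ⊢
  split_ifs at h ⊢ with h0
  · exact absurd h (lt_irrefl _)
  have hpos : 0 < P.dmin * P.Pmin :=
    (mul_nonneg hP.dmin_nonneg hP.Pmin_nonneg).lt_of_ne (Ne.symm h0)
  have h1 : 0 < w - P.betaS / (P.dmin * P.Pmin) := by
    by_contra hle
    rw [max_eq_left (not_lt.1 hle)] at h
    exact lt_irrefl _ h
  exact ⟨hpos, max_eq_right h1.le, (div_le_iff₀ hpos).1 (by linarith)⟩

lemma alphaS_eq_one {P : DCParams} (hP : P.Valid) {w : ℕ}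
    (h : P.betaS ≤ w * (P.dmin * P.Pmin)) : P.alphaS w = 1 :=
  min_eq_left ((one_le_div hP.betaS_pos).2 h)

/-- The amount by which the ratio of CHASE exceeds `1`. -/
noncomputable def chaseExcess (P : DCParams) (v : ℝ) : ℝ :=
  2 * ((P.Pmax - P.co) / P.Pmax) / P.chaseConst v

lemma chaseExcess_mul {P : DCParams} (hP : P.Valid) {v : ℝ} (hv : 0 ≤ v) :
    P.chaseConst v / 2 * P.chaseExcess v = (P.Pmax - P.co) / P.Pmax := by
  have := one_le_chaseConst hP hv
  unfold chaseExcess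
  field_simp

lemma chaseExcess_nonneg {P : DCParams} (hP : P.Valid) {v : ℝ} (hv : 0 ≤ v) :
    0 ≤ P.chaseExcess v := by
  have := one_le_chaseConst hP hv
  exact div_nonneg (mul_nonneg zero_le_two (div_nonneg (by linarith [co_lt_Pmax hP])
    (Pmax_pos hP).le)) (by linarith)

lemma ratio_eq {P : DCParams} (hP : P.Valid) (w : ℕ) :
    P.ratio w = P.gridFactor * (2 - P.alphaS w) * (1 + P.chaseExcess (P.remainingWindow w)) := by
  have hm : 0 < P.Pmax - P.co := by linarith [co_lt_Pmax hP]
  have hPm := Pmax_pos hP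
  have hD := maxDiff_pos hP
  have hβ := hP.betaG_pos
  have hκ := one_le_chaseConst hP (P.remainingWindow_nonneg w)
  have hα := alphaG_nonneg hP w
  have hden : P.L * P.Pmax + P.alphaG w * P.Pmax * (P.L - P.cm / (P.Pmax - P.co))
      = P.Pmax * P.maxDiff / (P.Pmax - P.co) * P.chaseConst (P.remainingWindow w) := by
    have h1 : P.chaseConst (P.remainingWindow w) = 1 + P.cm / P.maxDiff + P.alphaG w := by
      unfold chaseConst alphaG; ring
    have h2 : P.L = (P.maxDiff + P.cm) / (P.Pmax - P.co) := by
      rw [eq_div_iff hm.ne']; unfold maxDiff; ring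
    rw [h1, h2]
    field_simp
    ring
  have hfrac : 2 * (P.L * P.Pmax - P.L * P.co - P.cm) /
      (P.L * P.Pmax + P.alphaG w * P.Pmax * (P.L - P.cm / (P.Pmax - P.co)))
      = P.chaseExcess (P.remainingWindow w) := by
    rw [hden, chaseExcess]
    change 2 * P.maxDiff / _ = _
    field_simp
  unfold ratio
  rw [hfrac, gridFactor]
  ring

lemma ratio_le_ratioBound {P : DCParams} (hP : P.Valid) (w : ℕ) :
    P.ratio w ≤ P.ratioBound w := by
  have hm : 0 < P.Pmax - P.co := by linarith [co_lt_Pmax hP]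
  have hα := alphaG_nonneg hP w
  have hF := one_le_gridFactor hP
  have h1 : 1 + P.alphaG w ≤ P.chaseConst (P.remainingWindow w) := by
    have : P.chaseConst (P.remainingWindow w) = 1 + P.cm / P.maxDiff + P.alphaG w := by
      unfold chaseConst alphaG; ring
    have := div_nonneg hP.cm_nonneg (maxDiff_pos hP).le
    linarith
  have h2 : P.chaseExcess (P.remainingWindow w)
      ≤ 2 * ((P.Pmax - P.co) / P.Pmax) * (1 / (1 + P.alphaG w)) := by
    rw [mul_one_div]
    exact div_le_div_of_nonneg_left (mul_nonneg zero_le_two (div_nonneg hm.le (Pmax_pos hP).le))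
      (by linarith) h1
  have h3 : P.ratioBound w = P.gridFactor * (2 - P.alphaS w)
      * (1 + 2 * ((P.Pmax - P.co) / P.Pmax) * (1 / (1 + P.alphaG w))) := by
    unfold ratioBound gridFactor; ring
  rw [ratio_eq hP, h3]
  refine mul_le_mul_of_nonneg_left (by linarith) (mul_nonneg (by linarith) ?_)
  linarith [P.alphaS_le_one w]

end DCParams

/-! ### The cost of DCMON -/

namespace DCInput

section

variable {I : DCInput} {P : DCParams}

lemma cost_eq (I : DCInput) (P : DCParams) (x y : ℕ → ℕ) :
    I.cost P x y = ∑ t ∈ Finset.Icc 1 I.T, P.psi (y t) (I.p t) (I.d t (x t))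
      + P.betaS * upSwitches x I.T + P.betaG * upSwitches y I.T := by
  unfold cost upSwitches
  simp only [Finset.sum_add_distrib, Finset.mul_sum]

/-- Grid power costs at most `gridFactor` times as much as any other supply. -/
lemma gridCost_le_cost (hI : I.Valid P) (hP : P.Valid) (x y : ℕ → ℕ) :
    I.gridCost P x ≤ P.gridFactor * I.cost P x y := by
  have hF := P.one_le_gridFactor hP
  have h1 : ∑ t ∈ Finset.Icc 1 I.T, I.p t * I.d t (x t)
      ≤ P.gridFactor * ∑ t ∈ Finset.Icc 1 I.T, P.psi (y t) (I.p t) (I.d t (x t)) := by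
    rw [Finset.mul_sum]
    refine Finset.sum_le_sum fun t ht => ?_
    have ht1 := (Finset.mem_Icc.1 ht).1
    exact DCParams.grid_le_psi hP (hI.price_nonneg hP ht1) (hI.price_le t ht1)
      (hI.d_nonneg ht1 _) _
  have h2 : P.betaS * upSwitches x I.T ≤ P.gridFactor * (P.betaS * upSwitches x I.T) := by
    have := mul_nonneg hP.betaS_pos.le (upSwitches_nonneg x I.T)
    nlinarith
  have h3 := mul_nonneg (by linarith : 0 ≤ P.gridFactor)
    (mul_nonneg hP.betaG_pos.le (upSwitches_nonneg y I.T))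
  rw [cost_eq, gridCost]
  linarith

/-- Under CHASE, the cost of a server schedule is at most its grid cost plus the excess costs of the
generators. -/
lemma cost_chase_le (hI : I.Valid P) (hP : P.Valid) (x : ℕ → ℕ) (n : ℕ) :
    I.cost P x (P.chase I.p (fun s => I.d s (x s)) n) ≤ I.gridCost P x
      + ∑ i ∈ Finset.range P.N, P.excess I.p (fun s => I.d s (x s)) i
          (P.chaseState I.p (fun s => I.d s (x s)) n i) I.T := by
  set e : ℕ → ℝ := fun s => I.d s (x s) with he
  have h1 : ∑ t ∈ Finset.Icc 1 I.T, P.psi (P.chase I.p e n t) (I.p t) (e t)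
      ≤ ∑ t ∈ Finset.Icc 1 I.T, (I.p t * e t
        - ∑ i ∈ Finset.range P.N, P.costDiff I.p e i t * P.chaseState I.p e n i t) :=
    Finset.sum_le_sum fun t ht => DCParams.psi_le_sub_costDiff
      (p := I.p) (e := e) hP (hI.d_nonneg (Finset.mem_Icc.1 ht).1 _) P.N (fun i => P.chaseState I.p e n i t)
      fun i => P.chaseState_eq I.p e n i t
  have h2 := mul_le_mul_of_nonneg_left
    (upSwitches_sum_le P.N (fun i => P.chaseState I.p e n i) I.T) hP.betaG_pos.le
  have h3 : upSwitches (P.chase I.p e n) I.T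
      = upSwitches (fun u => ∑ i ∈ Finset.range P.N, P.chaseState I.p e n i u) I.T := rfl
  rw [Finset.sum_sub_distrib, Finset.sum_comm] at h1
  rw [cost_eq, gridCost, h3]
  simp only [DCParams.excess, Finset.sum_sub_distrib, ← Finset.mul_sum]
  simp only [he] at h1 h2 ⊢
  linarith

/-- The credits of all generators are paid for by the grid cost of the demand. -/
lemma sum_credit_le (hI : I.Valid P) (hP : P.Valid) (x : ℕ → ℕ) :
    ∑ i ∈ Finset.range P.N, ∑ t ∈ Finset.Icc 1 I.T, P.chaseCredit I.p (fun s => I.d s (x s)) i t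
      ≤ (P.Pmax - P.co) / P.Pmax * I.gridCost P x := by
  have hθ : 0 ≤ (P.Pmax - P.co) / P.Pmax :=
    div_nonneg (by linarith [DCParams.co_lt_Pmax hP]) (DCParams.Pmax_pos hP).le
  rw [Finset.sum_comm]
  have h1 : ∑ t ∈ Finset.Icc 1 I.T,
      ∑ i ∈ Finset.range P.N, P.chaseCredit I.p (fun s => I.d s (x s)) i t
      ≤ ∑ t ∈ Finset.Icc 1 I.T, (P.Pmax - P.co) / P.Pmax * (I.p t * I.d t (x t)) := by
    refine Finset.sum_le_sum fun t ht => ?_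
    have ht1 := (Finset.mem_Icc.1 ht).1
    have hp0 := hI.price_nonneg hP ht1
    calc ∑ i ∈ Finset.range P.N, P.chaseCredit I.p (fun s => I.d s (x s)) i t
        ≤ ∑ i ∈ Finset.range P.N, (P.Pmax - P.co) / P.Pmax
            * (I.p t * P.subDemand (fun s => I.d s (x s)) i t) :=
          Finset.sum_le_sum fun i _ => (DCParams.chaseCredit_le hP _ _ _ _).trans
            (DCParams.saving_le hP hp0 (hI.price_le t ht1) (DCParams.subDemand_nonneg hP _ _ _))
      _ ≤ _ := by
        rw [← Finset.mul_sum, ← Finset.mul_sum]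
        exact mul_le_mul_of_nonneg_left (mul_le_mul_of_nonneg_left
          (DCParams.sum_subDemand_le hP (hI.d_nonneg ht1 _) _) hp0) hθ
  rw [← Finset.mul_sum] at h1
  refine h1.trans (mul_le_mul_of_nonneg_left ?_ hθ)
  rw [gridCost]
  linarith [mul_nonneg hP.betaS_pos.le (upSwitches_nonneg x I.T)]

/-- The competitive ratio when the window left to CHASE is empty or contains a further slot. -/
lemma cost_dcmon_le_of_credit (hI : I.Valid P) (hP : P.Valid) {w : ℕ}
    (hv : 1 ≤ ⌊P.remainingWindow w⌋₊ ∨ P.remainingWindow w = 0) {x y : ℕ → ℕ}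
    (hxy : I.Feasible P x y) :
    I.cost P (I.dcmonX P w) (I.dcmonY P w) ≤ P.ratio w * I.cost P x y := by
  have hv0 := P.remainingWindow_nonneg w
  set v := P.remainingWindow w with hvdef
  have hκ := DCParams.one_le_chaseConst hP hv0
  have hθ := DCParams.chaseExcess_nonneg hP hv0
  have hα := P.alphaS_le_one w
  have h1 := cost_chase_le hI hP (I.gcsr P w) ⌊v⌋₊
  have h2 : ∀ i ∈ Finset.range P.N,
      P.chaseConst v / 2 * P.excess I.p (fun s => I.d s (I.gcsr P w s)) i
        (P.chaseState I.p (fun s => I.d s (I.gcsr P w s)) ⌊v⌋₊ i) I.T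
      ≤ ∑ t ∈ Finset.Icc 1 I.T, P.chaseCredit I.p (fun s => I.d s (I.gcsr P w s)) i t := by
    intro i _
    have := DCParams.excess_chase_le_credit (p := I.p) (e := fun s => I.d s (I.gcsr P w s))
      (i := i) (T := I.T) hP hv0 (Nat.lt_floor_add_one v).le le_rfl
      (hv.imp_right fun h => by rw [h]; simp) hI.price_le (fun hn t ht => by
        have hpos : 0 < v := by
          by_contra hle
          rw [Nat.floor_of_nonpos (not_lt.1 hle)] at hn
          omega
        have hw := (DCParams.betaS_le_of_remainingWindow_pos hP hpos).2.2
        simp only [gcsr_after hI hP hw ht, d, hI.workload_after t ht, Nat.cast_zero]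
        exact hI.power_after t ht)
    linarith
  have h3 := Finset.sum_le_sum h2
  rw [← Finset.mul_sum] at h3
  have h4 := h3.trans (sum_credit_le hI hP (I.gcsr P w))
  rw [← DCParams.chaseExcess_mul hP hv0, mul_assoc] at h4
  have h5 := le_of_mul_le_mul_left h4 (by linarith)
  have h6 := gridCost_gcsr_le hI hP w hxy.x_zero hxy.workload_le
  have h7 := mul_le_mul_of_nonneg_left (gridCost_le_cost hI hP x y)
    (by linarith : 0 ≤ 2 - P.alphaS w)
  have h8 := mul_le_mul_of_nonneg_left (h6.trans h7) (by linarith : 0 ≤ 1 + P.chaseExcess v)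
  rw [DCParams.ratio_eq hP]
  calc I.cost P (I.dcmonX P w) (I.dcmonY P w)
      ≤ I.gridCost P (I.gcsr P w) + P.chaseExcess v * I.gridCost P (I.gcsr P w) :=
        h1.trans (by linarith)
    _ ≤ (1 + P.chaseExcess v) * ((2 - P.alphaS w) * (P.gridFactor * I.cost P x y)) := by
        linarith
    _ = _ := by ring

/-- The demand when, in addition to the servers of `x`, those are on that GCSR keeps on. -/
noncomputable def jointDemand (I : DCInput) (P : DCParams) (w : ℕ) (x : ℕ → ℕ) (t : ℕ) : ℝ :=
  I.d t (x t) + ∑ i ∈ Finset.range I.numServers,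
    I.subPower i t * ((I.gcsrState P w i t).1 * (1 - levelSeq x i t))

lemma one_sub_levelSeq_nonneg (x : ℕ → ℕ) (i t : ℕ) : (0 : ℝ) ≤ 1 - levelSeq x i t := by
  rcases levelSeq_eq x i t with h | h <;> simp [h]

lemma le_jointDemand (hI : I.Valid P) (hP : P.Valid) (w : ℕ) (x : ℕ → ℕ) {t : ℕ} (ht : 1 ≤ t) :
    I.d t (x t) ≤ I.jointDemand P w x t :=
  le_add_of_nonneg_right (Finset.sum_nonneg fun i _ => mul_nonneg (hI.subPower_nonneg hP ht i)
    (mul_nonneg (Nat.cast_nonneg _) (one_sub_levelSeq_nonneg x i t)))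

lemma gcsr_le_jointDemand (hI : I.Valid P) (hP : P.Valid) (w : ℕ) (x : ℕ → ℕ) {t : ℕ}
    (ht : 1 ≤ t) : I.d t (I.gcsr P w t) ≤ I.jointDemand P w x t := by
  have h1 := hI.d_sum_le ht (fun i => (I.gcsrState P w i t).1)
    (fun i => I.gcsrState_fst P w i t) I.numServers
  have h2 := hI.le_d hP ht x I.numServers
  have h3 : ∑ i ∈ Finset.range I.numServers, I.subPower i t * ((I.gcsrState P w i t).1 : ℝ)
      ≤ ∑ i ∈ Finset.range I.numServers, I.subPower i t * levelSeq x i t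
        + ∑ i ∈ Finset.range I.numServers,
          I.subPower i t * ((I.gcsrState P w i t).1 * (1 - levelSeq x i t)) := by
    rw [← Finset.sum_add_distrib]
    refine Finset.sum_le_sum fun i _ => ?_
    have hs := hI.subPower_nonneg hP ht i
    rw [← mul_add]
    refine mul_le_mul_of_nonneg_left ?_ hs
    rcases levelSeq_eq x i t with h | h <;> rcases I.gcsrState_fst P w i t with h' | h' <;>
      simp [h, h']
  exact h1.trans (by unfold jointDemand; linarith)

/-- The additional demand costs at most what `x` spends on switching servers. -/
lemma sum_jointDemand_le (hI : I.Valid P) (hP : P.Valid) {w : ℕ}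
    (hw : P.betaS ≤ w * (P.dmin * P.Pmin)) {x : ℕ → ℕ}
    (hx : ∀ t, 1 ≤ t → t ≤ I.T → I.a t ≤ x t) :
    ∑ t ∈ Finset.Icc 1 I.T, I.p t * (I.jointDemand P w x t - I.d t (x t))
      ≤ P.betaS * upSwitches x I.T := by
  have h1 : ∑ t ∈ Finset.Icc 1 I.T, I.p t * (I.jointDemand P w x t - I.d t (x t))
      = ∑ i ∈ Finset.range I.numServers, ∑ t ∈ Finset.Icc 1 I.T,
        I.idleCost i t * ((I.gcsrState P w i t).1 * (1 - levelSeq x i t)) := by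
    rw [Finset.sum_comm]
    refine Finset.sum_congr rfl fun t _ => ?_
    unfold jointDemand idleCost
    rw [add_sub_cancel_left, Finset.mul_sum]
    exact Finset.sum_congr rfl fun i _ => by ring
  rw [h1]
  calc _ ≤ ∑ i ∈ Finset.range I.numServers, P.betaS * upSwitches (levelSeq x i) I.T :=
        Finset.sum_le_sum fun i _ => sum_idle_le_switching hP (hI.idleBound hP i) hw
          (levelSeq_eq x i) (fun t ht hT hb => levelSeq_of_workload (hx t ht hT) hb)
          (fun t ht => hI.not_workload_after ht i)
    _ ≤ _ := by
        rw [← Finset.mul_sum]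
        exact mul_le_mul_of_nonneg_left (sum_upSwitches_levelSeq_le _ x I.T) hP.betaS_pos.le

/-- The competitive ratio when the window left to CHASE has a positive length, but contains only the
current slot. The deficit of CHASE is made up for by the slack of the solution `(x, y)`, once its
demand is raised to `jointDemand`. -/
lemma cost_dcmon_le_of_deficit (hI : I.Valid P) (hP : P.Valid) {w : ℕ}
    (hn : ⌊P.remainingWindow w⌋₊ = 0) (hpos : 0 < P.remainingWindow w) {x y : ℕ → ℕ}
    (hxy : I.Feasible P x y) :
    I.cost P (I.dcmonX P w) (I.dcmonY P w) ≤ P.ratio w * I.cost P x y := by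
  have hv0 := P.remainingWindow_nonneg w
  have hw := (DCParams.betaS_le_of_remainingWindow_pos hP hpos).2.2
  have hα := DCParams.alphaS_eq_one hP hw
  set v := P.remainingWindow w with hvdef
  have hv1 : v ≤ 1 := by
    have := (Nat.lt_floor_add_one v).le
    rw [hn] at this
    simpa using this
  have hκ := DCParams.one_le_chaseConst hP hv0
  have hθ := DCParams.chaseExcess_nonneg hP hv0
  have hF := P.one_le_gridFactor hP
  have hcm := hP.cm_nonneg
  have hm : 0 ≤ (P.Pmax - P.co) / P.Pmax :=
    div_nonneg (by linarith [DCParams.co_lt_Pmax hP]) (DCParams.Pmax_pos hP).le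
  have h1 := cost_chase_le hI hP (I.gcsr P w) 0
  set e : ℕ → ℝ := fun s => I.d s (I.gcsr P w s) with he
  set e' : ℕ → ℝ := I.jointDemand P w x with he'
  set F := P.gridFactor with hFdef
  set κ := P.chaseConst v with hκdef
  have he'0 : ∀ t, 1 ≤ t → 0 ≤ e' t := fun t ht =>
    (hI.d_nonneg ht _).trans (le_jointDemand hI hP w x ht)
  -- the deficits of all generators
  have h2 : ∀ i ∈ Finset.range P.N,
      κ / 2 * P.excess I.p e i (P.chaseState I.p e 0 i) I.T
      ≤ ∑ t ∈ Finset.Icc 1 I.T, ((P.Pmax - P.co) / P.Pmax * (I.p t * P.subDemand e' i t)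
          + κ / 2 * P.slotSlack (I.p t) (P.subDemand e' i t) (levelSeq y i t))
        + κ / 2 * (F * P.betaG) * upSwitches (levelSeq y i) I.T := fun i _ =>
    (DCParams.excess_chase_le_credit hP hv0 (by simpa using hv1)
      (by positivity : 0 ≤ P.cm * v / 2) (Or.inr le_rfl) hI.price_le (by omega)).trans
    (DCParams.credit_add_deficit_le hP hv0 hv1 (levelSeq_eq y i) (by simp [levelSeq, hxy.y_zero])
      (fun t ht => hI.price_nonneg hP ht) hI.price_le
      fun t ht _ => gcsr_le_jointDemand hI hP w x ht)
  have h3 := Finset.sum_le_sum h2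
  rw [← Finset.mul_sum, Finset.sum_add_distrib, Finset.sum_comm, ← Finset.mul_sum] at h3
  have h4 : ∑ t ∈ Finset.Icc 1 I.T, ∑ i ∈ Finset.range P.N,
      ((P.Pmax - P.co) / P.Pmax * (I.p t * P.subDemand e' i t)
          + κ / 2 * P.slotSlack (I.p t) (P.subDemand e' i t) (levelSeq y i t))
      ≤ ∑ t ∈ Finset.Icc 1 I.T, ((P.Pmax - P.co) / P.Pmax * (I.p t * e' t)
          + κ / 2 * (F * P.psi (y t) (I.p t) (e' t) - I.p t * e' t)) := by
    refine Finset.sum_le_sum fun t ht => ?_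
    have ht1 := (Finset.mem_Icc.1 ht).1
    have hp0 := hI.price_nonneg hP ht1
    rw [Finset.sum_add_distrib, ← Finset.mul_sum, ← Finset.mul_sum, ← Finset.mul_sum]
    refine add_le_add (mul_le_mul_of_nonneg_left (mul_le_mul_of_nonneg_left
      (DCParams.sum_subDemand_le hP (he'0 t ht1) _) hp0) hm)
      (mul_le_mul_of_nonneg_left (le_trans (Eq.le ?_) (DCParams.slack_le hP hp0 (he'0 t ht1)
        (hxy.y_le t ht1 (Finset.mem_Icc.1 ht).2))) (by linarith))
    refine Finset.sum_congr rfl fun i _ => ?_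
    unfold DCParams.slotSlack levelSeq
    push_cast
    rfl
  have h5 := mul_le_mul_of_nonneg_left (sum_upSwitches_levelSeq_le P.N y I.T)
    (mul_nonneg (by linarith : 0 ≤ κ / 2) (mul_nonneg (by linarith : 0 ≤ F) hP.betaG_pos.le))
  -- the costs of `(x, y)` with the joint demand
  have h6 := sum_jointDemand_le hI hP hw hxy.workload_le
  have h7 : ∑ t ∈ Finset.Icc 1 I.T, P.psi (y t) (I.p t) (e' t)
      ≤ ∑ t ∈ Finset.Icc 1 I.T, P.psi (y t) (I.p t) (I.d t (x t))
        + ∑ t ∈ Finset.Icc 1 I.T, I.p t * (e' t - I.d t (x t)) := by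
    rw [← Finset.sum_add_distrib]
    exact Finset.sum_le_sum fun t ht => DCParams.psi_le_add hP _ _
      (le_jointDemand hI hP w x (Finset.mem_Icc.1 ht).1)
  have h8 : ∑ t ∈ Finset.Icc 1 I.T, I.p t * e' t
      ≤ F * ∑ t ∈ Finset.Icc 1 I.T, P.psi (y t) (I.p t) (e' t) := by
    rw [Finset.mul_sum]
    refine Finset.sum_le_sum fun t ht => ?_
    have ht1 := (Finset.mem_Icc.1 ht).1
    exact DCParams.grid_le_psi hP (hI.price_nonneg hP ht1) (hI.price_le t ht1) (he'0 t ht1) _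
  have h9 := gridCost_gcsr_le hI hP w hxy.x_zero hxy.workload_le
  have h10 : I.gridCost P x = ∑ t ∈ Finset.Icc 1 I.T, I.p t * e' t
      + (P.betaS * upSwitches x I.T
        - ∑ t ∈ Finset.Icc 1 I.T, I.p t * (e' t - I.d t (x t))) := by
    simp only [gridCost, mul_sub, Finset.sum_sub_distrib]
    ring
  have h11 := I.cost_eq P x y
  have hup := mul_nonneg hP.betaG_pos.le (upSwitches_nonneg y I.T)
  rw [hα] at h9
  set G := ∑ t ∈ Finset.Icc 1 I.T, I.p t * e' t
  set Ψ := ∑ t ∈ Finset.Icc 1 I.T, P.psi (y t) (I.p t) (e' t)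
  set Z := ∑ t ∈ Finset.Icc 1 I.T, I.p t * (e' t - I.d t (x t))
  set E := ∑ i ∈ Finset.range P.N, P.excess I.p e i (P.chaseState I.p e 0 i) I.T
  set σ := P.betaS * upSwitches x I.T - Z with hσ
  have hσ0 : 0 ≤ σ := by linarith
  have h12 : Ψ + σ + P.betaG * upSwitches y I.T ≤ I.cost P x y := by linarith
  have h13 : κ / 2 * E ≤ (P.Pmax - P.co) / P.Pmax * G
      + κ / 2 * (F * Ψ - G + F * (P.betaG * upSwitches y I.T)) := by
    refine h3.trans ((add_le_add h4 h5).trans_eq ?_)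
    simp only [Finset.sum_add_distrib, ← Finset.mul_sum, Finset.sum_sub_distrib, G, Ψ]
    ring
  rw [← DCParams.chaseExcess_mul hP hv0, ← hκdef, mul_assoc, ← mul_add] at h13
  have h14 := le_of_mul_le_mul_left h13 (by linarith)
  have h15 := mul_le_mul_of_nonneg_left h12 (by linarith : 0 ≤ F)
  have hFσ : σ ≤ F * σ := by nlinarith
  have hFup : 0 ≤ F * (P.betaG * upSwitches y I.T) := mul_nonneg (by linarith) hup
  have h16 : P.chaseExcess v * G ≤ P.chaseExcess v * (F * I.cost P x y) :=
    mul_le_mul_of_nonneg_left (by linarith) hθ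
  have h17 : I.cost P (I.dcmonX P w) (I.dcmonY P w) ≤ I.gridCost P (I.gcsr P w) + E := by
    have : I.dcmonY P w = P.chase I.p e 0 := by
      funext t
      unfold dcmonY
      rw [← hvdef, hn]
      rfl
    rw [this]
    exact h1
  rw [DCParams.ratio_eq hP, hα, ← hvdef]
  linarith

/-- DCMON is feasible. -/
lemma feasible_dcmon (I : DCInput) (P : DCParams) (w : ℕ) :
    I.Feasible P (I.dcmonX P w) (I.dcmonY P w) where
  x_zero := by simp [dcmonX, gcsr, gcsrState]
  y_zero := by simp [dcmonY, DCParams.chase, DCParams.chaseState]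
  workload_le t ht hT := workload_le_gcsr ht hT w
  y_le t _ _ := by
    unfold dcmonY DCParams.chase
    calc _ ≤ ∑ _i ∈ Finset.range P.N, 1 := Finset.sum_le_sum fun i _ => by
          rcases P.chaseState_eq I.p (fun s => I.d s (I.dcmonX P w s)) ⌊P.remainingWindow w⌋₊ i t
            with h | h <;> omega
      _ = P.N := by simp

end

/-! ### Online decisions -/

section

variable {I J : DCInput} {P : DCParams} {w H : ℕ}

lemma AgreeUpTo.symm (h : I.AgreeUpTo J H) : J.AgreeUpTo I H := fun t h1 h2 =>
  ⟨(h t h1 h2).1.symm, (h t h1 h2).2.1.symm, (h t h1 h2).2.2.symm⟩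

lemma AgreeUpTo.d_eq (h : I.AgreeUpTo J H) {t : ℕ} (h1 : 1 ≤ t) (h2 : t ≤ H) (n : ℕ) :
    I.d t n = J.d t n := by
  unfold d; rw [(h t h1 h2).1, (h t h1 h2).2.2]

lemma AgreeUpTo.idleCost_eq (h : I.AgreeUpTo J H) {t : ℕ} (h1 : 1 ≤ t) (h2 : t ≤ H) (i : ℕ) :
    I.p t * I.subPower i t = J.p t * J.subPower i t := by
  unfold subPower; rw [(h t h1 h2).2.1, h.d_eq h1 h2, h.d_eq h1 h2]

lemma AgreeUpTo.subWorkload_eq (h : I.AgreeUpTo J H) {t : ℕ} (h1 : 1 ≤ t) (h2 : t ≤ H) (i : ℕ) :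
    I.subWorkload i t = J.subWorkload i t := by
  unfold subWorkload; rw [(h t h1 h2).1]

/-- Whether a server is turned off at `t` can be decided from the slots up to `H`, if the window
does not extend beyond `H`, or if the idling cost reaches `β_s` by the slot `H`. -/
lemma AgreeUpTo.gcsrOff (h : I.AgreeUpTo J H) {i t : ℕ} (ht : 1 ≤ t) {C : ℝ} (hC : 0 ≤ C)
    (hH : t + w ≤ H ∨ (t ≤ H ∧ H ≤ t + w ∧
      P.betaS ≤ ∑ u ∈ Finset.Icc t H, I.p u * I.subPower i u))
    (hoff : I.GcsrOff P w i t C) : J.GcsrOff P w i t C := by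
  obtain ⟨s, hs, hb⟩ := hoff
  have hsH : s ≤ H := by
    rcases hH with hH | ⟨h1, h2, h3⟩
    · exact hs.1.1.2.trans hH
    · exact hs.2 ⟨⟨h1, h2⟩, by linarith⟩
  have hsum : ∀ r ≤ H, ∑ u ∈ Finset.Icc t r, I.p u * I.subPower i u
      = ∑ u ∈ Finset.Icc t r, J.p u * J.subPower i u := fun r hr =>
    Finset.sum_congr rfl fun u hu => h.idleCost_eq (ht.trans (Finset.mem_Icc.1 hu).1)
      ((Finset.mem_Icc.1 hu).2.trans hr) i
  refine ⟨s, ⟨⟨hs.1.1, ?_⟩, fun r hr => ?_⟩, fun u hu => ?_⟩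
  · rw [← hsum s hsH]; exact hs.1.2
  · rcases le_total r H with hrH | hrH
    · refine hs.2 ⟨hr.1, ?_⟩
      rw [hsum r hrH]; exact hr.2
    · exact hsH.trans hrH
  · rw [← h.subWorkload_eq (ht.trans hu.1) (hu.2.trans hsH)]
    exact hb u hu

lemma AgreeUpTo.gcsrState_eq (h : I.AgreeUpTo J H) (hI : I.Valid P) (hJ : J.Valid P)
    (hP : P.Valid) {n : ℕ} (hn : n ≤ H)
    (hH : ∀ t, 1 ≤ t → t ≤ n → t + w ≤ H ∨
      (H ≤ t + w ∧ P.betaS ≤ (H + 1 - t : ℕ) * (P.dmin * P.Pmin))) (i : ℕ) :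
    ∀ t ≤ n, I.gcsrState P w i t = J.gcsrState P w i t := by
  intro t
  induction t with
  | zero => intro _; rfl
  | succ t ih =>
    intro ht
    have ih := ih (by omega)
    have hbI := hI.idleBound hP i
    have hbJ := hJ.idleBound hP i
    have hsum : ∀ {K : DCInput}, K.IdleBound i (P.dmin * P.Pmin) →
        (t + 1) + w ≤ H ∨ (t + 1 ≤ H ∧ H ≤ (t + 1) + w ∧
          P.betaS ≤ ∑ u ∈ Finset.Icc (t + 1) H, K.p u * K.subPower i u) := by
      intro K hK
      refine (hH (t + 1) (by omega) ht).imp_right fun h1 => ⟨by omega, h1.1, h1.2.trans ?_⟩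
      refine (hK.mul_le_sum (t := t + 1) (by omega) _).trans_eq (Finset.sum_congr ?_ fun _ _ => rfl)
      ext u; simp only [Finset.mem_Ico, Finset.mem_Icc]; omega
    have hW := h.subWorkload_eq (t := t + 1) (by omega) (ht.trans hn) i
    by_cases hb : 0 < I.subWorkload i (t + 1)
    · rw [gcsrState_succ_busy hb, gcsrState_succ_busy (hW ▸ hb)]
    have hb' : ¬ 0 < J.subWorkload i (t + 1) := hW ▸ hb
    by_cases hoff : I.GcsrOff P w i (t + 1) (I.gcsrState P w i t).2
    · have hoff' := h.gcsrOff (by omega) (gcsrState_snd_nonneg hbI.cost_nonneg t) (hsum hbI) hoff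
      rw [ih] at hoff'
      rw [gcsrState_succ_off hb hoff, gcsrState_succ_off hb' hoff']
    · have hoff' : ¬ J.GcsrOff P w i (t + 1) (J.gcsrState P w i t).2 := fun hoff' => hoff (by
        have := h.symm.gcsrOff (by omega) (gcsrState_snd_nonneg hbJ.cost_nonneg t) (hsum hbJ) hoff'
        rwa [← ih] at this)
      have hc : I.idleCost i (t + 1) = J.idleCost i (t + 1) :=
        h.idleCost_eq (by omega) (ht.trans hn) i
      rw [gcsrState_succ_stay hb hoff, gcsrState_succ_stay hb' hoff', ih, hc]

/-- The servers beyond `numServers` are never on, so that the number of servers does not matter. -/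
lemma gcsr_eq_sum (hI : I.Valid P) {n : ℕ} (hn : I.numServers ≤ n) (t : ℕ) :
    I.gcsr P w t = ∑ i ∈ Finset.range n, (I.gcsrState P w i t).1 := by
  refine Finset.sum_subset (Finset.range_mono hn) fun i _ hi => ?_
  induction t with
  | zero => rfl
  | succ t ih =>
    have hb : ¬ 0 < I.subWorkload i (t + 1) := fun hb =>
      hi (Finset.mem_range.2 (hI.lt_numServers (by omega) hb))
    by_cases hoff : I.GcsrOff P w i (t + 1) (I.gcsrState P w i t).2
    · rw [gcsrState_succ_off hb hoff]
    · rw [gcsrState_succ_stay hb hoff, ih]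

/-- The servers in the slots of the window left to CHASE are known: beyond the current slot this
window is nonempty only if a server breaks even within the rest of the window. -/
lemma AgreeUpTo.gcsr_eq (hP : P.Valid) (hI : I.Valid P) (hJ : J.Valid P) {t : ℕ}
    (h : I.AgreeUpTo J (t + w)) :
    ∀ s ≤ t + ⌊P.remainingWindow w⌋₊, I.gcsr P w s = J.gcsr P w s := by
  have hv0 := P.remainingWindow_nonneg w
  have hnv := Nat.floor_le hv0
  set n := ⌊P.remainingWindow w⌋₊ with hn
  have hnw : n ≤ w := P.floor_remainingWindow_le hP w
  intro s hs
  rw [gcsr_eq_sum hI (le_max_left I.numServers J.numServers),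
    gcsr_eq_sum hJ (le_max_right I.numServers J.numServers)]
  refine Finset.sum_congr rfl fun i _ => ?_
  rw [h.gcsrState_eq hI hJ hP (n := t + n) (by omega) (fun u hu hun => ?_) i s hs]
  rcases le_or_gt u t with hut | hut
  · left; omega
  · right
    refine ⟨by omega, ?_⟩
    have hpos : 0 < P.remainingWindow w :=
      lt_of_lt_of_le (by exact_mod_cast (by omega : 0 < n)) hnv
    obtain ⟨h1, h2, -⟩ := DCParams.betaS_le_of_remainingWindow_pos hP hpos
    rw [h2] at hnv
    rw [← div_le_iff₀ h1]
    have h3 : (w : ℝ) - n ≤ (t + w + 1 - u : ℕ) := by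
      rw [← Nat.cast_sub hnw]
      exact_mod_cast (by omega : w - n ≤ t + w + 1 - u)
    linarith

end

end DCInput

namespace DCParams

section

variable {P : DCParams} {p p' e e' : ℕ → ℝ} {n v : ℕ}

lemma cumDiff_congr (hp : ∀ t, 1 ≤ t → t ≤ n → p t = p' t)
    (he : ∀ t, 1 ≤ t → t ≤ n → e t = e' t) (i : ℕ) :
    ∀ t ≤ n, P.cumDiff p e i t = P.cumDiff p' e' i t := by
  intro t
  induction t with
  | zero => intro _; rfl
  | succ t ih =>
    intro ht
    rw [cumDiff, cumDiff, ih (by omega)]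
    simp only [costDiff, subDemand, hp _ (by omega) ht, he _ (by omega) ht]

lemma nextHit_congr {i t s : ℕ} (hs : s ≤ n)
    (h : ∀ u ≤ n, P.cumDiff p e i u = P.cumDiff p' e' i u)
    (hnext : P.NextHit p e i t s) : P.NextHit p' e' i t s := by
  refine ⟨hnext.1, ?_, fun u hu hu' => ?_⟩
  · rw [← h s hs]; exact hnext.2.1
  · rw [← h u (by omega)]; exact hnext.2.2 u hu hu'

/-- CHASE depends on the prices and demands in its window only. -/
lemma chaseState_congr (hp : ∀ t, 1 ≤ t → t ≤ n → p t = p' t)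
    (he : ∀ t, 1 ≤ t → t ≤ n → e t = e' t) (i : ℕ) :
    ∀ t, t + v ≤ n → P.chaseState p e v i t = P.chaseState p' e' v i t := by
  have hc := cumDiff_congr (P := P) hp he i
  intro t
  induction t with
  | zero => intro _; rfl
  | succ t ih =>
    intro ht
    by_cases hex : ∃ s, P.NextHit p e i t s ∧ s ≤ t + 1 + v
    · obtain ⟨s, hs, hsv⟩ := hex
      have hs' := nextHit_congr (hsv.trans ht) hc hs
      by_cases h0 : P.cumDiff p e i s = 0
      · rw [chaseState_succ_of_zero hs hsv h0,
          chaseState_succ_of_zero hs' hsv (by rwa [← hc s (hsv.trans ht)])]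
      · rw [chaseState_succ_of_neg hs hsv h0,
          chaseState_succ_of_neg hs' hsv (by rwa [← hc s (hsv.trans ht)])]
    · push Not at hex
      rw [chaseState_succ_of_none hex, chaseState_succ_of_none, ih (by omega)]
      intro s hs
      by_contra hle
      have := hex s (nextHit_congr ((not_lt.1 hle).trans ht) (fun u hu => (hc u hu).symm) hs)
      omega

end

end DCParams

/-- The decisions of DCMON at slot `t` depend only on the input in the slots `1, …, t + w`. -/
lemma DCInput.AgreeUpTo.dcmon_eq {P : DCParams} (hP : P.Valid) {w : ℕ} {I J : DCInput}
    (hI : I.Valid P) (hJ : J.Valid P) {t : ℕ} (h : I.AgreeUpTo J (t + w)) :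
    I.dcmonX P w t = J.dcmonX P w t ∧ I.dcmonY P w t = J.dcmonY P w t := by
  have hx := h.gcsr_eq hP hI hJ
  have hnw := P.floor_remainingWindow_le hP w
  refine ⟨hx t (by omega), ?_⟩
  unfold DCInput.dcmonY DCParams.chase
  refine Finset.sum_congr rfl fun i _ => ?_
  refine DCParams.chaseState_congr (n := t + ⌊P.remainingWindow w⌋₊)
    (fun s h1 h2 => (h s h1 (by omega)).2.1) (fun s h1 h2 => ?_) i t le_rfl
  simp only [DCInput.dcmonX]
  rw [hx s h2, h.d_eq h1 (by omega)]

theorem theorem8 (P : DCParams) (hP : P.Valid) (w : ℕ) :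
    -- online: the decisions at slot `t` depend only on the input in the slots `1, …, t + w`
    (∀ I J : DCInput, I.Valid P → J.Valid P → ∀ t : ℕ, I.AgreeUpTo J (t + w) →
      I.dcmonX P w t = J.dcmonX P w t ∧ I.dcmonY P w t = J.dcmonY P w t) ∧
    -- competitive ratio
    (∀ I : DCInput, I.Valid P →
      I.Feasible P (I.dcmonX P w) (I.dcmonY P w) ∧
      ∀ x y : ℕ → ℕ, I.Feasible P x y →
        I.cost P (I.dcmonX P w) (I.dcmonY P w) ≤ P.ratio w * I.cost P x y) ∧
    -- simpler upper bound of the ratio, and the ranges of the normalized window sizes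
    P.ratio w ≤ P.ratioBound w ∧
    0 ≤ P.alphaS w ∧ P.alphaS w ≤ 1 ∧ 0 ≤ P.alphaG w := by
  refine ⟨fun I J hI hJ t h => h.dcmon_eq hP hI hJ,
    fun I hI => ⟨I.feasible_dcmon P w, fun x y hxy => ?_⟩, DCParams.ratio_le_ratioBound hP w,
    DCParams.alphaS_nonneg hP w, P.alphaS_le_one w, DCParams.alphaG_nonneg hP w⟩
  rcases (P.remainingWindow_nonneg w).eq_or_lt with h0 | h0
  · exact DCInput.cost_dcmon_le_of_credit hI hP (Or.inr h0.symm) hxy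
  · rcases Nat.eq_zero_or_pos ⌊P.remainingWindow w⌋₊ with hn | hn
    · exact DCInput.cost_dcmon_le_of_deficit hI hP hn h0 hxy
    · exact DCInput.cost_dcmon_le_of_credit hI hP (Or.inl hn) hxy
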